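/- Let $\mathcal X,\mathcal Y_1,\mathcal Y_2$ be finite sets and let $Q_{Y_1,Y_2|X}$ be a broadcast channel, used without memory and without feedback. Logarithms are to base $2$. An $(n,R_0,R_1,R_2)$ code has message sets $\mathcal M_j=[1:2^{nR_j}]$, i.e. $\mathcal M_j=\{1,\dots,\lfloor 2^{nR_j}\rfloor\}$, $j=0,1,2$, a stochastic encoder $\mathcal M_0\times\mathcal M_1\times\mathcal M_2\to\mathcal P(\mathcal X^n)$, and decoders $\phi_j:\mathcal Y_j^n\to(\mathcal M_0\times\mathcal M_j)\cup\{e\}$, $j=1,2$, where $e$ is an error symbol. The messages $M_0,M_1,M_2$ are independent and uniform. For $L_1,L_2\ge 0$, a triple $(R_0,R_1,R_2)\in\mathbb R_+^3$ is $(L_1,L_2)$-achievable if for all $\epsilon,\xi_1,\xi_2>0$ there are arbitrarily large $n$ and $(n,R_0,R_1,R_2)$ codes with $$\mathbb P\big(\phi_1(Y_1^n)\ne(M_0,M_1)\text{ or }\phi_2(Y_2^n)\ne(M_0,M_2)\big)\le\epsilon,\quad \tfrac1n I(M_1;Y_2^n)\le L_1+\xi_1,\quad \tfrac1n I(M_2;Y_1^n)\le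 L_2+\xi_2 .$$ The leakage-capacity region $\mathcal C(L_1,L_2)$ is the closure of the set of $(L_1,L_2)$-achievable triples. Let $\mathcal R_{\mathrm O}(L_1,L_2)$ be the closure of the union, over all finite alphabets of $W,U,V$ and all PMFs $P_{W,U,V}P_{X|U,V}Q_{Y_1,Y_2|X}$, of the sets of triples $(R_0,R_1,R_2)\in\mathbb R_+^3$ satisfying \begin{align*} R_0&\le \min\{I(W;Y_1),I(W;Y_2)\} &&(2a)\\ R_1&\le I(U;Y_1|W,V)-I(U;Y_2|W,V)+L_1 &&(2b)\\ R_1&\le I(U;Y_1|W)-I(U;Y_2|W)+L_1 &&(2c)\\ R_0+R_1&\le I(U;Y_1|W)+\min\{I(W;Y_1),I(W;Y_2)\} &&(2d)\\ R_2&\le I(V;Y_2|W,U)-I(V;Y_1|W,U)+L_2 &&(2e)\\ R_2&\le I(V;Y_2|W)-I(V;Y_1|W)+L_2 &&(2f)\\ R_0+R_2&\le I(V;Y_2|W)+\min\{I(W;Y_1),I(W;Y_2)\} &&(2g)\\ R_0+R_1+R_2&\le I(U;Y_1|W,V)+I(V;Y_2|W)+\min\{I(W;Y_1),I(W;Y_2)\}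 &&(2h)\\ R_0+R_1+R_2&\le I(U;Y_1|W)+I(V;Y_2|W,U)+\min\{I(W;Y_1),I(W;Y_2)\}. &&(2i) \end{align*} Then for all $L_1,L_2\ge0$: $\mathcal C(L_1,L_2)\subseteq\mathcal R_{\mathrm O}(L_1,L_2)$, and $\mathcal R_{\mathrm O}(L_1,L_2)$ is convex. Moreover, let the UVW outer bound be the closure of the union, over all PMFs $P_{W,U,V,X}Q_{Y_1,Y_2|X}$ with finite alphabets of $W,U,V$, of the sets of triples in $\mathbb R_+^3$ satisfying (2a), (2d), (2g), (2h), (2i). The region $\mathcal R_{\mathrm O}(\infty,\infty)$, defined like $\mathcal R_{\mathrm O}(L_1,L_2)$ but without (2b), (2c), (2e), (2f), equals the UVW outer bound, and there is a finite $\Lambda\ge0$, depending only on the channel, such that $\mathcal R_{\mathrm O}(L_1,L_2)$ equals the UVW outer bound for all $L_1,L_2\ge\Lambda$. -/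

import Mathlib

namespace LeakageBC

/-! ### Shannon information measures on finite alphabets

A probability mass function on a finite set `Ω` is an element of `stdSimplex ℝ Ω`; a random variable
on it is a function on `Ω`. All logarithms are to base 2. -/

section Information

variable {Ω α β γ : Type*} [Fintype Ω] [Fintype α] [Fintype β] [Fintype γ]

open Classical in
/-- The probability of the event `A` under the mass function `P`. -/
noncomputable def prob (P : Ω → ℝ) (A : Ω → Prop) : ℝ :=
  ∑ ω, if A ω then P ω else 0

/-- The entropy `H(A)` in bits of the random variable `A` under the mass function `P`. -/
noncomputable def entropy (P : Ω → ℝ) (A : Ω → α) : ℝ :=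
  ∑ a, Real.negMulLog (prob P (fun ω => A ω = a)) / Real.log 2

/-- The conditional entropy `H(A | C) = H(A, C) - H(C)`. -/
noncomputable def condEntropy (P : Ω → ℝ) (A : Ω → α) (C : Ω → γ) : ℝ :=
  entropy P (fun ω => (A ω, C ω)) - entropy P C

/-- The mutual information `I(A; B) = H(A) - H(A | B)`. -/
noncomputable def mutualInfo (P : Ω → ℝ) (A : Ω → α) (B : Ω → β) : ℝ :=
  entropy P A - condEntropy P A B

/-- The conditional mutual information `I(A; B | C) = H(A | C) - H(A | B, C)`. -/
noncomputable def condMutualInfo (P : Ω → ℝ) (A : Ω → α) (B : Ω → β) (C : Ω → γ) : ℝ :=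
  condEntropy P A C - condEntropy P A (fun ω => (B ω, C ω))

end Information

/-! ### Codes, achievability and the leakage-capacity region

The broadcast channel `Q_{Y₁,Y₂|X}` is `Q : X → Y₁ × Y₂ → ℝ`, with `Q x` a mass function for
every `x`. -/

/-- The message set `[1 : 2^{nR}]`; it has `⌊2^{nR}⌋` elements. -/
abbrev Msg (n : ℕ) (R : ℝ) : Type := Fin ⌊(2 : ℝ) ^ ((n : ℝ) * R)⌋₊

/-- The message triples `(m₀, m₁, m₂)`. -/
abbrev Msgs (n : ℕ) (R₀ R₁ R₂ : ℝ) : Type := Msg n R₀ × Msg n R₁ × Msg n R₂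

/-- An `(n, R₀, R₁, R₂)` code: a stochastic encoder and two decoders; `none` is the error symbol. -/
structure Code (X Y₁ Y₂ : Type*) [Fintype X] (n : ℕ) (R₀ R₁ R₂ : ℝ) where
  enc : Msgs n R₀ R₁ R₂ → (Fin n → X) → ℝ
  enc_mem : ∀ m, enc m ∈ stdSimplex ℝ (Fin n → X)
  dec₁ : (Fin n → Y₁) → Option (Msg n R₀ × Msg n R₁)
  dec₂ : (Fin n → Y₂) → Option (Msg n R₀ × Msg n R₂)

/-- The sample space of `(M₀, M₁, M₂)`, `X^n`, `Y₁^n`, `Y₂^n`. -/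
abbrev CodeSpace (X Y₁ Y₂ : Type*) (n : ℕ) (R₀ R₁ R₂ : ℝ) : Type _ :=
  Msgs n R₀ R₁ R₂ × (Fin n → X) × (Fin n → Y₁) × (Fin n → Y₂)

namespace Code

variable {X Y₁ Y₂ : Type*} [Fintype X] [Fintype Y₁] [Fintype Y₂] {n : ℕ} {R₀ R₁ R₂ : ℝ}

/-- The mass function induced by the code: independent and uniform messages, the stochastic encoder,
and the memoryless channel. -/
noncomputable def law (c : Code X Y₁ Y₂ n R₀ R₁ R₂) (Q : X → Y₁ × Y₂ → ℝ) :
    CodeSpace X Y₁ Y₂ n R₀ R₁ R₂ → ℝ :=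
  fun (m, x, y₁, y₂) =>
    (1 / (Fintype.card (Msgs n R₀ R₁ R₂) : ℝ)) * c.enc m x * ∏ i, Q (x i) (y₁ i, y₂ i)

/-- The average error probability: receiver 1 misses `(M₀, M₁)` or receiver 2 misses `(M₀, M₂)`. -/
noncomputable def errorProb (c : Code X Y₁ Y₂ n R₀ R₁ R₂) (Q : X → Y₁ × Y₂ → ℝ) : ℝ :=
  prob (c.law Q) (fun (m, _, y₁, y₂) =>
    c.dec₁ y₁ ≠ some (m.1, m.2.1) ∨ c.dec₂ y₂ ≠ some (m.1, m.2.2))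

/-- The leakage `(1/n) I(M₁; Y₂^n)` of `M₁` to receiver 2. -/
noncomputable def leakage₁ (c : Code X Y₁ Y₂ n R₀ R₁ R₂) (Q : X → Y₁ × Y₂ → ℝ) : ℝ :=
  (1 / (n : ℝ)) * mutualInfo (c.law Q) (fun (m, _, _, _) => m.2.1) (fun (_, _, _, y₂) => y₂)

/-- The leakage `(1/n) I(M₂; Y₁^n)` of `M₂` to receiver 1. -/
noncomputable def leakage₂ (c : Code X Y₁ Y₂ n R₀ R₁ R₂) (Q : X → Y₁ × Y₂ → ℝ) : ℝ :=
  (1 / (n : ℝ)) * mutualInfo (c.law Q) (fun (m, _, _, _) => m.2.2) (fun (_, _, y₁, _) => y₁)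

end Code

section Regions

variable {X Y₁ Y₂ : Type*} [Fintype X] [Fintype Y₁] [Fintype Y₂]

/-- `(R₀, R₁, R₂) ∈ ℝ₊³` is `(L₁, L₂)`-achievable: for all `ε, ξ₁, ξ₂ > 0` there are arbitrarily large
block lengths `n` with an `(n, R₀, R₁, R₂)` code of error probability at most `ε` and leakages at most
`L₁ + ξ₁` and `L₂ + ξ₂`. -/
def Achievable (Q : X → Y₁ × Y₂ → ℝ) (L₁ L₂ R₀ R₁ R₂ : ℝ) : Prop :=
  0 ≤ R₀ ∧ 0 ≤ R₁ ∧ 0 ≤ R₂ ∧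
    ∀ ε > 0, ∀ ξ₁ > 0, ∀ ξ₂ > 0, ∀ N : ℕ, ∃ n > N, ∃ c : Code X Y₁ Y₂ n R₀ R₁ R₂,
      c.errorProb Q ≤ ε ∧ c.leakage₁ Q ≤ L₁ + ξ₁ ∧ c.leakage₂ Q ≤ L₂ + ξ₂

/-- The `(L₁, L₂)`-leakage-capacity region `C(L₁, L₂)`. -/
def capacityRegion (Q : X → Y₁ × Y₂ → ℝ) (L₁ L₂ : ℝ) : Set (ℝ × ℝ × ℝ) :=
  closure {R | Achievable Q L₁ L₂ R.1 R.2.1 R.2.2}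

/-! ### Single-letter regions -/

/-- The sample space of `(W, U, V, X, Y₁, Y₂)`; auxiliary alphabets are arbitrary finite sets,
labelled by `Fin a`, `Fin b`, `Fin c`. -/
abbrev Letters (a b c : ℕ) (X Y₁ Y₂ : Type*) : Type _ :=
  Fin a × Fin b × Fin c × X × Y₁ × Y₂

/-- The mass function `P_{W,U,V,X} Q_{Y₁,Y₂|X}`. -/
def jointLaw {a b c : ℕ} (P : Fin a × Fin b × Fin c × X → ℝ) (Q : X → Y₁ × Y₂ → ℝ) :
    Letters a b c X Y₁ Y₂ → ℝ :=
  fun (w, u, v, x, y₁, y₂) => P (w, u, v, x) * Q x (y₁, y₂)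

/-- The mass function `P_{W,U,V} P_{X|U,V}`. -/
def inputLaw {a b c : ℕ} (P : Fin a × Fin b × Fin c → ℝ) (K : Fin b × Fin c → X → ℝ) :
    Fin a × Fin b × Fin c × X → ℝ :=
  fun (w, u, v, x) => P (w, u, v) * K (u, v) x

section Bounds

variable {a b c : ℕ} (p : Letters a b c X Y₁ Y₂ → ℝ)

/-- `min {I(W; Y₁), I(W; Y₂)}`. -/
noncomputable def minInfoW : ℝ :=
  min (mutualInfo p (fun (w, _, _, _, _, _) => w) (fun (_, _, _, _, y₁, _) => y₁))
    (mutualInfo p (fun (w, _, _, _, _, _) => w) (fun (_, _, _, _, _, y₂) => y₂))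

/-- `I(U; Y₁ | W)`. -/
noncomputable def infoU1 : ℝ :=
  condMutualInfo p (fun (_, u, _, _, _, _) => u) (fun (_, _, _, _, y₁, _) => y₁)
    (fun (w, _, _, _, _, _) => w)

/-- `I(U; Y₂ | W)`. -/
noncomputable def infoU2 : ℝ :=
  condMutualInfo p (fun (_, u, _, _, _, _) => u) (fun (_, _, _, _, _, y₂) => y₂)
    (fun (w, _, _, _, _, _) => w)

/-- `I(V; Y₁ | W)`. -/
noncomputable def infoV1 : ℝ :=
  condMutualInfo p (fun (_, _, v, _, _, _) => v) (fun (_, _, _, _, y₁, _) => y₁)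
    (fun (w, _, _, _, _, _) => w)

/-- `I(V; Y₂ | W)`. -/
noncomputable def infoV2 : ℝ :=
  condMutualInfo p (fun (_, _, v, _, _, _) => v) (fun (_, _, _, _, _, y₂) => y₂)
    (fun (w, _, _, _, _, _) => w)

/-- `I(U; Y₁ | W, V)`. -/
noncomputable def infoU1V : ℝ :=
  condMutualInfo p (fun (_, u, _, _, _, _) => u) (fun (_, _, _, _, y₁, _) => y₁)
    (fun (w, _, v, _, _, _) => (w, v))

/-- `I(U; Y₂ | W, V)`. -/
noncomputable def infoU2V : ℝ :=
  condMutualInfo p (fun (_, u, _, _, _, _) => u) (fun (_, _, _, _, _, y₂) => y₂)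
    (fun (w, _, v, _, _, _) => (w, v))

/-- `I(V; Y₁ | W, U)`. -/
noncomputable def infoV1U : ℝ :=
  condMutualInfo p (fun (_, _, v, _, _, _) => v) (fun (_, _, _, _, y₁, _) => y₁)
    (fun (w, u, _, _, _, _) => (w, u))

/-- `I(V; Y₂ | W, U)`. -/
noncomputable def infoV2U : ℝ :=
  condMutualInfo p (fun (_, _, v, _, _, _) => v) (fun (_, _, _, _, _, y₂) => y₂)
    (fun (w, u, _, _, _, _) => (w, u))

/-- The five rate bounds without leakage thresholds, for `(R₀, R₁, R₂) ∈ ℝ₊³`. -/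
structure RateBounds (R₀ R₁ R₂ : ℝ) : Prop where
  nonneg₀ : 0 ≤ R₀
  nonneg₁ : 0 ≤ R₁
  nonneg₂ : 0 ≤ R₂
  bound₀ : R₀ ≤ minInfoW p
  bound₀₁ : R₀ + R₁ ≤ infoU1 p + minInfoW p
  bound₀₂ : R₀ + R₂ ≤ infoV2 p + minInfoW p
  bound_sum₁ : R₀ + R₁ + R₂ ≤ infoU1V p + infoV2 p + minInfoW p
  bound_sum₂ : R₀ + R₁ + R₂ ≤ infoU1 p + infoV2U p + minInfoW p

/-- The four rate bounds with leakage thresholds. -/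
structure LeakageBounds (L₁ L₂ R₁ R₂ : ℝ) : Prop where
  bound₁_cond : R₁ ≤ infoU1V p - infoU2V p + L₁
  bound₁ : R₁ ≤ infoU1 p - infoU2 p + L₁
  bound₂_cond : R₂ ≤ infoV2U p - infoV1U p + L₂
  bound₂ : R₂ ≤ infoV2 p - infoV1 p + L₂

end Bounds

/-- `R_O(L₁, L₂)`: closure of the union over all `P_{W,U,V} P_{X|U,V} Q_{Y₁,Y₂|X}` of the sets of rate
triples that satisfy all nine bounds. -/
def outerRegion (Q : X → Y₁ × Y₂ → ℝ) (L₁ L₂ : ℝ) : Set (ℝ × ℝ × ℝ) :=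
  closure {R | ∃ (a b c : ℕ) (P : Fin a × Fin b × Fin c → ℝ) (K : Fin b × Fin c → X → ℝ),
    P ∈ stdSimplex ℝ (Fin a × Fin b × Fin c) ∧ (∀ uv, K uv ∈ stdSimplex ℝ X) ∧
    RateBounds (jointLaw (inputLaw P K) Q) R.1 R.2.1 R.2.2 ∧
    LeakageBounds (jointLaw (inputLaw P K) Q) L₁ L₂ R.2.1 R.2.2}

/-- `R_O(∞, ∞)`: the four bounds with leakage thresholds are removed. -/
def outerRegionInactive (Q : X → Y₁ × Y₂ → ℝ) : Set (ℝ × ℝ × ℝ) :=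
  closure {R | ∃ (a b c : ℕ) (P : Fin a × Fin b × Fin c → ℝ) (K : Fin b × Fin c → X → ℝ),
    P ∈ stdSimplex ℝ (Fin a × Fin b × Fin c) ∧ (∀ uv, K uv ∈ stdSimplex ℝ X) ∧
    RateBounds (jointLaw (inputLaw P K) Q) R.1 R.2.1 R.2.2}

/-- The UVW outer bound for the broadcast channel without secrecy: here `P_{W,U,V,X}` is arbitrary,
that is, `(W, U, V) - X - (Y₁, Y₂)` is the only Markov relation. -/
def uvwRegion (Q : X → Y₁ × Y₂ → ℝ) : Set (ℝ × ℝ × ℝ) :=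
  closure {R | ∃ (a b c : ℕ) (P : Fin a × Fin b × Fin c × X → ℝ),
    P ∈ stdSimplex ℝ (Fin a × Fin b × Fin c × X) ∧
    RateBounds (jointLaw P Q) R.1 R.2.1 R.2.2}

end Regions

end LeakageBC

/-! The converse takes W_i = (M₀, Y₁^{i-1}, Y₂_{i+1}^n), U = M₁ and V = M₂. Everything is phrased
with conditional entropies H(Y_j | W, [U], [V]). Their sums over time for the two outputs differ by
H(Y₁^n | C) - H(Y₂^n | C), where C consists of M₀ and the retained private messages; this is the
Csiszár sum identity (`csiszar_sum`). Together with Fano's inequality it turns all rate bounds into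
linear inequalities between n-letter entropies. The leakage bounds hold because receiver 2 decodes
(M₀, M₂), so adding these to Y₂^n costs only a Fano term, and symmetrically for receiver 1
(`approxBounds_of_fano`).

The factorization P_{W,U,V} P_{X|U,V} costs nothing: replacing U by (W, U) changes none of the
quantities, since W is always conditioned on next to U, and it makes X - (U, V) - W a Markov chain
(`exists_kernel`, `exists_inputLaw`). This also identifies the region without leakage bounds with
the UVW region.

A time-sharing variable T is absorbed into W. Quantities conditioned on W are then averaged, while
I(W; Y_j) can only exceed its average by concavity of H(Y_j) (`exists_inputLaw_timeSharing`). This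
single-letterizes the converse and yields convexity.

The converse leaves a vanishing slack. Positive rates are lowered to absorb it; a private rate equal
to zero cannot be lowered, so its auxiliary variable is dropped and its leakage bounds become 0 ≤
L_j (`mem_outerSet_of_approxBounds`). Finally, on finite alphabets all informations are bounded by
log-cardinalities, so large thresholds are inactive. -/

namespace LeakageBC

/-! ### Finite probability: events, marginals, images of mass functions -/

section Probability

variable {Ω Ω' α β γ : Type*} [Fintype Ω] {P : Ω → ℝ}

theorem prob_congr {A B : Ω → Prop} (h : ∀ ω, A ω ↔ B ω) : prob P A = prob P B := by
  rw [funext fun ω => propext (h ω)]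

theorem prob_eq_sum (A : Ω → Prop) [DecidablePred A] :
    prob P A = ∑ ω, if A ω then P ω else 0 := by
  unfold prob
  exact Finset.sum_congr rfl fun ω _ => by congr

theorem prob_nonneg (hP : ∀ ω, 0 ≤ P ω) (A : Ω → Prop) : 0 ≤ prob P A := by
  classical
  rw [prob_eq_sum]
  exact Finset.sum_nonneg fun ω _ => by split_ifs <;> simp [hP]

theorem prob_mono (hP : ∀ ω, 0 ≤ P ω) {A B : Ω → Prop} (h : ∀ ω, A ω → B ω) :
    prob P A ≤ prob P B := by
  classical
  rw [prob_eq_sum, prob_eq_sum]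
  refine Finset.sum_le_sum fun ω _ => ?_
  by_cases hA : A ω
  · simp [hA, h ω hA]
  · simp only [hA, if_false]
    split_ifs <;> simp [hP]

theorem le_prob (hP : ∀ ω, 0 ≤ P ω) {A : Ω → Prop} {ω : Ω} (h : A ω) : P ω ≤ prob P A := by
  classical
  rw [prob_eq_sum]
  calc P ω = if A ω then P ω else 0 := by simp [h]
    _ ≤ _ := Finset.single_le_sum (f := fun ω => if A ω then P ω else 0)
        (fun ω _ => by split_ifs <;> simp [hP]) (Finset.mem_univ ω)

theorem prob_eq_zero {A : Ω → Prop} (h : ∀ ω, ¬ A ω) : prob P A = 0 := by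
  classical
  rw [prob_eq_sum]
  exact Finset.sum_eq_zero fun ω _ => by simp [h ω]

theorem prob_eq_single {A : Ω → Prop} (ω₀ : Ω) (h : ∀ ω, A ω ↔ ω = ω₀) : prob P A = P ω₀ := by
  classical
  rw [prob_congr h, prob_eq_sum]
  simp

theorem sum_mul_prob [Fintype α] (A : Ω → α) (g : α → ℝ) :
    ∑ a, prob P (fun ω => A ω = a) * g a = ∑ ω, P ω * g (A ω) := by
  classical
  simp_rw [prob_eq_sum, Finset.sum_mul]
  rw [Finset.sum_comm]
  refine Finset.sum_congr rfl fun ω _ => ?_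
  simp [ite_mul]

theorem sum_prob_and [Fintype α] (A : Ω → α) (E : Ω → Prop) :
    ∑ a, prob P (fun ω => E ω ∧ A ω = a) = prob P E := by
  classical
  simp_rw [prob_eq_sum, ite_and]
  rw [Finset.sum_comm]
  refine Finset.sum_congr rfl fun ω _ => ?_
  by_cases h : E ω <;> simp [h]

theorem sum_prob [Fintype α] (A : Ω → α) : ∑ a, prob P (fun ω => A ω = a) = ∑ ω, P ω := by
  simpa using sum_mul_prob (P := P) A (fun _ => 1)

/-- The image of a mass function under a map. -/
noncomputable def push (P : Ω → ℝ) (f : Ω → Ω') : Ω' → ℝ := fun ω' => prob P (fun ω => f ω = ω')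

theorem push_mem [Fintype Ω'] (hP : P ∈ stdSimplex ℝ Ω) (f : Ω → Ω') :
    push P f ∈ stdSimplex ℝ Ω' :=
  ⟨fun _ => prob_nonneg hP.1 _, by unfold push; rw [sum_prob, hP.2]⟩

theorem prob_push [Fintype Ω'] (f : Ω → Ω') (A : Ω' → Prop) :
    prob (push P f) A = prob P (fun ω => A (f ω)) := by
  classical
  rw [prob_eq_sum, prob_eq_sum]
  simpa [push] using sum_mul_prob (P := P) f (fun a => if A a then 1 else 0)

theorem entropy_push [Fintype Ω'] [Fintype α] (f : Ω → Ω') (A : Ω' → α) :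
    entropy (push P f) A = entropy P (fun ω => A (f ω)) := by
  simp only [entropy, prob_push]

end Probability

/-! ### Shannon inequalities -/

section Entropy

variable {Ω α β γ δ : Type*} [Fintype Ω] [Fintype α] [Fintype β] [Fintype γ] [Fintype δ]
  {P : Ω → ℝ}

theorem log_two_pos : 0 < Real.log 2 := Real.log_pos (by norm_num)

/-- Writing entropy as an expectation over the sample space puts variables with different alphabets
on the same footing, so that they can be compared pointwise. -/
theorem entropy_eq_sum (A : Ω → α) :
    entropy P A = ∑ ω, P ω * (-Real.log (prob P fun ω' => A ω' = A ω) / Real.log 2) := by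
  rw [← sum_mul_prob A (fun a => -Real.log (prob P fun ω' => A ω' = a) / Real.log 2)]
  unfold entropy
  refine Finset.sum_congr rfl fun a _ => ?_
  rw [Real.negMulLog]
  ring

/-- Entropy depends only on the partition that a random variable induces. -/
theorem entropy_congr {A : Ω → α} {B : Ω → β} (h : ∀ ω ω', A ω' = A ω ↔ B ω' = B ω) :
    entropy P A = entropy P B := by
  rw [entropy_eq_sum, entropy_eq_sum]
  exact Finset.sum_congr rfl fun ω _ => by rw [prob_congr (h ω)]

theorem entropy_mono (hP : P ∈ stdSimplex ℝ Ω) {A : Ω → α} {B : Ω → β}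
    (h : ∀ ω ω', A ω' = A ω → B ω' = B ω) : entropy P B ≤ entropy P A := by
  rw [entropy_eq_sum, entropy_eq_sum]
  refine Finset.sum_le_sum fun ω _ => ?_
  rcases (hP.1 ω).eq_or_lt with h0 | h0
  · rw [← h0]; simp
  · have h1 : 0 < prob P fun ω' => A ω' = A ω := h0.trans_le (le_prob hP.1 rfl)
    have h2 := Real.log_le_log h1 (prob_mono hP.1 (h ω))
    have := log_two_pos
    gcongr

/-- Gibbs' inequality, from log s ≤ s - 1. Strong subadditivity, the cardinality bound and Fano's
inequality are all instances, each with its own likelihood ratio s. -/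
theorem sum_mul_log_nonpos (hP : P ∈ stdSimplex ℝ Ω) (s : Ω → ℝ) (hs : ∀ ω, 0 < P ω → 0 < s ω)
    (hsum : ∑ ω, P ω * s ω ≤ 1) : ∑ ω, P ω * Real.log (s ω) ≤ 0 := by
  have h : ∑ ω, P ω * Real.log (s ω) ≤ ∑ ω, (P ω * s ω - P ω) := by
    refine Finset.sum_le_sum fun ω _ => ?_
    rcases (hP.1 ω).eq_or_lt with h0 | h0
    · rw [← h0]; simp
    · nlinarith [Real.log_le_sub_one_of_pos (hs ω h0)]
  rw [Finset.sum_sub_distrib, hP.2] at h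
  linarith

/-- Strong subadditivity of entropy. -/
theorem entropy_submodular (hP : P ∈ stdSimplex ℝ Ω) (A : Ω → α) (B : Ω → β) (C : Ω → γ) :
    entropy P (fun ω => (A ω, B ω, C ω)) + entropy P C ≤
      entropy P (fun ω => (A ω, C ω)) + entropy P (fun ω => (B ω, C ω)) := by
  set p₁ : α → γ → ℝ := fun a c => prob P fun ω => (A ω, C ω) = (a, c) with hp₁
  set p₂ : β → γ → ℝ := fun b c => prob P fun ω => (B ω, C ω) = (b, c) with hp₂
  set p₀ : γ → ℝ := fun c => prob P fun ω => C ω = c with hp₀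
  set p : α → β → γ → ℝ := fun a b c => prob P fun ω => (A ω, B ω, C ω) = (a, b, c) with hp
  have pos : ∀ ω, 0 < P ω → 0 < p (A ω) (B ω) (C ω) ∧ 0 < p₁ (A ω) (C ω) ∧
      0 < p₂ (B ω) (C ω) ∧ 0 < p₀ (C ω) := fun ω h =>
    ⟨h.trans_le (le_prob hP.1 rfl), h.trans_le (le_prob hP.1 rfl),
      h.trans_le (le_prob hP.1 rfl), h.trans_le (le_prob hP.1 rfl)⟩
  have nn : ∀ E, 0 ≤ prob P E := prob_nonneg hP.1
  have m₁ : ∀ c, ∑ a, p₁ a c = p₀ c := fun c => by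
    simp only [hp₁, hp₀]
    rw [← sum_prob_and A]
    exact Finset.sum_congr rfl fun a _ => prob_congr fun ω => by simp [Prod.ext_iff, and_comm]
  have m₂ : ∀ c, ∑ b, p₂ b c = p₀ c := fun c => by
    simp only [hp₂, hp₀]
    rw [← sum_prob_and B]
    exact Finset.sum_congr rfl fun a _ => prob_congr fun ω => by simp [Prod.ext_iff, and_comm]
  -- The ratio compares p(a,b,c) with p(a,c) p(b,c) / p(c), the law that makes A and B conditionally
  -- independent given C; the latter has total mass 1.
  have key := sum_mul_log_nonpos hP
    (fun ω => p₁ (A ω) (C ω) * p₂ (B ω) (C ω) / (p (A ω) (B ω) (C ω) * p₀ (C ω)))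
    (fun ω h => by obtain ⟨h1, h2, h3, h4⟩ := pos ω h; positivity) (by
      rw [← sum_mul_prob (fun ω => (A ω, B ω, C ω))
        (fun z => p₁ z.1 z.2.2 * p₂ z.2.1 z.2.2 / (p z.1 z.2.1 z.2.2 * p₀ z.2.2))]
      have : ∀ z : α × β × γ, (prob P fun ω => (A ω, B ω, C ω) = z) *
          (p₁ z.1 z.2.2 * p₂ z.2.1 z.2.2 / (p z.1 z.2.1 z.2.2 * p₀ z.2.2)) ≤
          p₁ z.1 z.2.2 * p₂ z.2.1 z.2.2 / p₀ z.2.2 := by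
        rintro ⟨a, b, c⟩
        change p a b c * (p₁ a c * p₂ b c / (p a b c * p₀ c)) ≤ p₁ a c * p₂ b c / p₀ c
        have hnn : 0 ≤ p₁ a c * p₂ b c / p₀ c := div_nonneg (mul_nonneg (nn _) (nn _)) (nn _)
        by_cases h : p a b c = 0
        · simpa [h] using hnn
        · refine le_of_eq ?_
          rw [mul_div_assoc', mul_div_mul_left _ _ h]
      refine (Finset.sum_le_sum fun z _ => this z).trans ?_
      rw [Fintype.sum_prod_type]
      simp_rw [Fintype.sum_prod_type]
      have hc : ∑ a, ∑ b, ∑ c, p₁ a c * p₂ b c / p₀ c = ∑ c, p₀ c := by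
        calc ∑ a, ∑ b, ∑ c, p₁ a c * p₂ b c / p₀ c
            = ∑ c, ∑ a, ∑ b, p₁ a c * p₂ b c / p₀ c :=
              (Finset.sum_congr rfl fun a _ => Finset.sum_comm).trans Finset.sum_comm
          _ = ∑ c, p₀ c * p₀ c / p₀ c := by
              refine Finset.sum_congr rfl fun c _ => ?_
              have h := Finset.sum_mul_sum Finset.univ Finset.univ (fun a => p₁ a c)
                (fun b => p₂ b c)
              rw [m₁, m₂] at h
              simp_rw [h, Finset.sum_div]
          _ = ∑ c, p₀ c := Finset.sum_congr rfl fun c _ => by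
              by_cases h : p₀ c = 0 <;> simp [h]
      rw [hc, hp₀, sum_prob, hP.2])
  have split : ∑ ω, P ω * Real.log
      (p₁ (A ω) (C ω) * p₂ (B ω) (C ω) / (p (A ω) (B ω) (C ω) * p₀ (C ω))) =
      (entropy P (fun ω => (A ω, B ω, C ω)) + entropy P C -
      entropy P (fun ω => (A ω, C ω)) - entropy P (fun ω => (B ω, C ω))) * Real.log 2 := by
    simp only [entropy_eq_sum]
    rw [← Finset.sum_add_distrib, ← Finset.sum_sub_distrib, ← Finset.sum_sub_distrib,
      Finset.sum_mul]
    refine Finset.sum_congr rfl fun ω _ => ?_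
    rcases (hP.1 ω).eq_or_lt with h0 | h0
    · rw [← h0]; simp
    · obtain ⟨h1, h2, h3, h4⟩ := pos ω h0
      rw [Real.log_div (by positivity) (by positivity), Real.log_mul h2.ne' h3.ne',
        Real.log_mul h1.ne' h4.ne']
      have := log_two_pos
      field_simp
      simp only [hp, hp₁, hp₂, hp₀]
      ring
  rw [split] at key
  nlinarith [log_two_pos]

/-- Gibbs' inequality against the uniform law. -/
theorem entropy_le_log_card (hP : P ∈ stdSimplex ℝ Ω) (A : Ω → α) :
    entropy P A ≤ Real.log (Fintype.card α) / Real.log 2 := by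
  obtain ⟨ω₀⟩ : Nonempty Ω := by
    by_contra h
    rw [not_nonempty_iff] at h
    simpa using hP.2
  have : Nonempty α := ⟨A ω₀⟩
  have hc : (0 : ℝ) < Fintype.card α := by exact_mod_cast Fintype.card_pos
  have pos : ∀ ω, 0 < P ω → 0 < prob P fun ω' => A ω' = A ω :=
    fun ω h => h.trans_le (le_prob hP.1 rfl)
  have key := sum_mul_log_nonpos hP
    (fun ω => 1 / (Fintype.card α * prob P fun ω' => A ω' = A ω))
    (fun ω h => by have := pos ω h; positivity) (by
      rw [← sum_mul_prob A (fun a => 1 / (Fintype.card α * prob P fun ω' => A ω' = a))]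
      have : ∀ a, (prob P fun ω => A ω = a) * (1 / (Fintype.card α * prob P fun ω' => A ω' = a))
          ≤ 1 / Fintype.card α := fun a => by
        by_cases h : (prob P fun ω => A ω = a) = 0
        · rw [h]; simp
        · refine le_of_eq ?_
          field_simp
      refine (Finset.sum_le_sum fun a _ => this a).trans ?_
      simp [hc.ne'])
  have split : ∑ ω, P ω * Real.log (1 / (Fintype.card α * prob P fun ω' => A ω' = A ω)) =
      entropy P A * Real.log 2 - Real.log (Fintype.card α) := by
    have : Real.log (Fintype.card α) = ∑ ω, P ω * Real.log (Fintype.card α) := by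
      rw [← Finset.sum_mul, hP.2, one_mul]
    rw [this, entropy_eq_sum, Finset.sum_mul, ← Finset.sum_sub_distrib]
    refine Finset.sum_congr rfl fun ω _ => ?_
    rcases (hP.1 ω).eq_or_lt with h0 | h0
    · rw [← h0]; simp
    · rw [one_div, Real.log_inv, Real.log_mul hc.ne' (pos ω h0).ne']
      have := log_two_pos
      field_simp
      ring
  rw [split] at key
  rw [le_div_iff₀ log_two_pos]
  linarith

theorem entropy_eq_log_card {A : Ω → α}
    (h : ∀ a, prob P (fun ω => A ω = a) = 1 / (Fintype.card α : ℝ)) :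
    entropy P A = Real.log (Fintype.card α) / Real.log 2 := by
  unfold entropy
  simp only [h, Real.negMulLog, Finset.sum_const, Finset.card_univ, nsmul_eq_mul, one_div,
    Real.log_inv]
  rcases eq_or_ne (Fintype.card α : ℝ) 0 with h0 | h0
  · simp [h0]
  · field_simp

/-- Fano's inequality. -/
theorem fano (hP : P ∈ stdSimplex ℝ Ω) (M : Ω → α) (Y : Ω → β) (φ : β → Option α) {ε : ℝ}
    (hε : prob P (fun ω => φ (Y ω) ≠ some (M ω)) ≤ ε) :
    condEntropy P M Y ≤ 1 + ε * (Real.log (Fintype.card α) / Real.log 2) := by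
  classical
  obtain ⟨ω₀⟩ : Nonempty Ω := by
    by_contra h
    rw [not_nonempty_iff] at h
    simpa using hP.2
  have : Nonempty α := ⟨M ω₀⟩
  have hc : (1 : ℝ) ≤ Fintype.card α := by exact_mod_cast Fintype.card_pos
  set κ : ℝ := (Fintype.card α : ℝ) with hκ
  set p : α → β → ℝ := fun a b => prob P fun ω => (M ω, Y ω) = (a, b) with hp
  set p₀ : β → ℝ := fun b => prob P fun ω => Y ω = b with hp₀
  -- The reference law for M given Y = b puts mass 1/2 on the decoded value and spreads the other
  -- 1/2 uniformly. It costs at most 1 bit when decoding succeeds and 1 + log κ bits when it fails.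
  -- The masses sum to at most 1 because `q` is 1/2 rather than 1/2 + 1/(2κ) at the decoded value.
  set q : α → β → ℝ := fun a b => if φ b = some a then 1 / 2 else 1 / (2 * κ) with hq
  have qpos : ∀ a b, 0 < q a b := fun a b => by simp only [hq]; split_ifs <;> positivity
  have qsum : ∀ b, ∑ a, q a b ≤ 1 := fun b => by
    have : ∀ a, q a b ≤ (if φ b = some a then 1 / 2 else 0) + 1 / (2 * κ) := fun a => by
      simp only [hq]
      have : 0 < 1 / (2 * κ) := by positivity
      split_ifs <;> linarith
    refine (Finset.sum_le_sum fun a _ => this a).trans ?_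
    rw [Finset.sum_add_distrib]
    have h1 : ∑ a, (if φ b = some a then (1 / 2 : ℝ) else 0) ≤ 1 / 2 := by
      cases φ b with
      | none => simp
      | some a => simp
    have h2 : ∑ _a : α, 1 / (2 * κ) = 1 / 2 := by
      rw [Finset.sum_const, Finset.card_univ, nsmul_eq_mul, ← hκ]
      field_simp
    linarith
  have pos : ∀ ω, 0 < P ω → 0 < p (M ω) (Y ω) ∧ 0 < p₀ (Y ω) := fun ω h =>
    ⟨h.trans_le (le_prob hP.1 rfl), h.trans_le (le_prob hP.1 rfl)⟩
  have key := sum_mul_log_nonpos hP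
    (fun ω => p₀ (Y ω) * q (M ω) (Y ω) / p (M ω) (Y ω))
    (fun ω h => by obtain ⟨h1, h2⟩ := pos ω h; have := qpos (M ω) (Y ω); positivity) (by
      rw [← sum_mul_prob (fun ω => (M ω, Y ω)) (fun z => p₀ z.2 * q z.1 z.2 / p z.1 z.2)]
      have : ∀ z : α × β, (prob P fun ω => (M ω, Y ω) = z) *
          (p₀ z.2 * q z.1 z.2 / p z.1 z.2) ≤ p₀ z.2 * q z.1 z.2 := by
        rintro ⟨a, b⟩
        change p a b * (p₀ b * q a b / p a b) ≤ p₀ b * q a b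
        by_cases h : p a b = 0
        · rw [h, zero_mul]
          exact mul_nonneg (prob_nonneg hP.1 _) (qpos a b).le
        · refine le_of_eq ?_
          field_simp
      refine (Finset.sum_le_sum fun z _ => this z).trans ?_
      rw [Fintype.sum_prod_type_right]
      calc ∑ b, ∑ a, p₀ b * q a b ≤ ∑ b, p₀ b := Finset.sum_le_sum fun b _ => by
            rw [← Finset.mul_sum]
            exact mul_le_of_le_one_right (prob_nonneg hP.1 _) (qsum b)
        _ = 1 := by simp only [hp₀]; rw [sum_prob, hP.2])
  have split : (condEntropy P M Y - 1) * Real.log 2 -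
      prob P (fun ω => φ (Y ω) ≠ some (M ω)) * Real.log κ =
      ∑ ω, P ω * Real.log (p₀ (Y ω) * q (M ω) (Y ω) / p (M ω) (Y ω)) := by
    have h1 : (1 : ℝ) = ∑ ω, P ω := hP.2.symm
    rw [condEntropy, entropy_eq_sum, entropy_eq_sum, prob_eq_sum, h1, ← Finset.sum_sub_distrib,
      ← Finset.sum_sub_distrib, Finset.sum_mul, Finset.sum_mul, ← Finset.sum_sub_distrib]
    refine Finset.sum_congr rfl fun ω _ => ?_
    rcases (hP.1 ω).eq_or_lt with h0 | h0
    · rw [← h0]; simp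
    · obtain ⟨h2, h3⟩ := pos ω h0
      rw [Real.log_div (mul_pos h3 (qpos _ _)).ne' h2.ne', Real.log_mul h3.ne' (qpos _ _).ne']
      have := log_two_pos
      by_cases he : φ (Y ω) = some (M ω)
      · simp only [hq, he, ne_eq, not_true_eq_false, if_false, if_true, one_div, Real.log_inv]
        field_simp
        simp only [hp, hp₀]
        ring
      · simp only [hq, he, ne_eq, not_false_eq_true, if_false, if_true, one_div, Real.log_inv]
        rw [Real.log_mul (by norm_num) (by positivity)]
        field_simp
        simp only [hp, hp₀]
        ring
  rw [← split] at key
  have h3 := mul_le_mul_of_nonneg_right hε (Real.log_nonneg hc)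
  have h4 : condEntropy P M Y - 1 ≤ ε * Real.log κ / Real.log 2 := by
    rw [le_div_iff₀ log_two_pos]; linarith
  rw [mul_div_assoc] at h4
  linarith

end Entropy

/-! ### Information under relabelling, conditioning and product laws -/

section Relabelling

variable {Ω Ω' α β γ γ' δ T : Type*} [Fintype Ω] [Fintype Ω'] [Fintype α] [Fintype β] [Fintype γ]
  [Fintype γ'] [Fintype δ] [Fintype T] {P : Ω → ℝ}

theorem condEntropy_push (f : Ω → Ω') (A : Ω' → α) (C : Ω' → γ) :
    condEntropy (push P f) A C = condEntropy P (fun ω => A (f ω)) (fun ω => C (f ω)) := by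
  simp only [condEntropy, entropy_push]

theorem mutualInfo_push (f : Ω → Ω') (A : Ω' → α) (B : Ω' → β) :
    mutualInfo (push P f) A B = mutualInfo P (fun ω => A (f ω)) (fun ω => B (f ω)) := by
  simp only [mutualInfo, condEntropy_push, entropy_push]

theorem condMutualInfo_push (f : Ω → Ω') (A : Ω' → α) (B : Ω' → β) (C : Ω' → γ) :
    condMutualInfo (push P f) A B C =
      condMutualInfo P (fun ω => A (f ω)) (fun ω => B (f ω)) (fun ω => C (f ω)) := by
  simp only [condMutualInfo, condEntropy_push]

theorem condEntropy_congr {A : Ω → α} {A' : Ω → β} {C : Ω → γ} {C' : Ω → δ}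
    (hA : ∀ ω ω', A ω' = A ω ↔ A' ω' = A' ω) (hC : ∀ ω ω', C ω' = C ω ↔ C' ω' = C' ω) :
    condEntropy P A C = condEntropy P A' C' := by
  rw [condEntropy, condEntropy, entropy_congr hC,
    entropy_congr (B := fun ω => (A' ω, C' ω)) fun ω ω' => by simp [hA ω ω', hC ω ω']]

/-- `I(A; B | C) = H(B | C) - H(B | A, C)`, where `C'` and `D` carry the same information as
`C` and `(A, C)`. -/
theorem condMutualInfo_eq_sub {A : Ω → α} {B : Ω → β} {C : Ω → γ} {C' : Ω → γ'} {D : Ω → δ}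
    (hC : ∀ ω ω', C ω' = C ω ↔ C' ω' = C' ω)
    (hD : ∀ ω ω', (A ω' = A ω ∧ C ω' = C ω) ↔ D ω' = D ω) :
    condMutualInfo P A B C = condEntropy P B C' - condEntropy P B D := by
  rw [← condEntropy_congr (A := B) (A' := B) (fun _ _ => Iff.rfl) hC,
    ← condEntropy_congr (A := B) (A' := B) (C := fun ω => (A ω, C ω)) (C' := D)
      (fun _ _ => Iff.rfl) (fun ω ω' => by simpa using hD ω ω')]
  unfold condMutualInfo condEntropy
  rw [entropy_congr (A := fun ω => (A ω, B ω, C ω)) (B := fun ω => (B ω, A ω, C ω))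
    fun ω ω' => by simp; tauto]
  ring

/-- `I(A; B) = H(B) - H(B | A)`, where `D` carries the same information as `A`. -/
theorem mutualInfo_eq_sub {A : Ω → α} {B : Ω → β} {D : Ω → δ}
    (hD : ∀ ω ω', A ω' = A ω ↔ D ω' = D ω) :
    mutualInfo P A B = entropy P B - condEntropy P B D := by
  rw [← condEntropy_congr (A := B) (A' := B) (fun _ _ => Iff.rfl) hD]
  unfold mutualInfo condEntropy
  rw [entropy_congr (A := fun ω => (A ω, B ω)) (B := fun ω => (B ω, A ω))
    fun ω ω' => by simp; tauto]
  ring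

theorem entropy_unit (hP : P ∈ stdSimplex ℝ Ω) : entropy P (fun _ => ()) = 0 := by
  simp [entropy, prob, hP.2]

theorem condEntropy_nonneg (hP : P ∈ stdSimplex ℝ Ω) (A : Ω → α) (C : Ω → γ) :
    0 ≤ condEntropy P A C :=
  sub_nonneg.2 (entropy_mono hP fun _ _ h => congrArg Prod.snd h)

/-- Conditioning reduces entropy. -/
theorem condEntropy_anti (hP : P ∈ stdSimplex ℝ Ω) {A : Ω → α} {C : Ω → γ} {D : Ω → δ}
    (h : ∀ ω ω', D ω' = D ω → C ω' = C ω) : condEntropy P A D ≤ condEntropy P A C := by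
  have := entropy_submodular hP A D C
  unfold condEntropy
  rw [entropy_congr (A := fun ω => (A ω, D ω, C ω)) (B := fun ω => (A ω, D ω))
      fun ω ω' => by simpa using fun _ h' => h ω ω' h',
    entropy_congr (A := fun ω => (D ω, C ω)) (B := D)
      fun ω ω' => by simpa using h ω ω'] at this
  linarith

theorem condEntropy_le_entropy (hP : P ∈ stdSimplex ℝ Ω) (A : Ω → α) (C : Ω → γ) :
    condEntropy P A C ≤ entropy P A := by
  have := condEntropy_anti hP (A := A) (C := fun _ => ()) (D := C) fun _ _ _ => rfl
  refine this.trans_eq ?_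
  rw [condEntropy, entropy_unit hP, sub_zero]
  exact entropy_congr fun ω ω' => by simp

theorem condMutualInfo_nonneg (hP : P ∈ stdSimplex ℝ Ω) (A : Ω → α) (B : Ω → β) (C : Ω → γ) :
    0 ≤ condMutualInfo P A B C :=
  sub_nonneg.2 (condEntropy_anti hP fun _ _ h => congrArg Prod.snd h)

theorem mutualInfo_nonneg (hP : P ∈ stdSimplex ℝ Ω) (A : Ω → α) (B : Ω → β) :
    0 ≤ mutualInfo P A B :=
  sub_nonneg.2 (condEntropy_le_entropy hP A B)

/-- The product of two mass functions. -/
def mix (l : T → ℝ) (P : Ω → ℝ) : T × Ω → ℝ := fun z => l z.1 * P z.2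

variable {l : T → ℝ}

theorem mix_mem (hl : l ∈ stdSimplex ℝ T) (hP : P ∈ stdSimplex ℝ Ω) :
    mix l P ∈ stdSimplex ℝ (T × Ω) := by
  refine ⟨fun z => mul_nonneg (hl.1 _) (hP.1 _), ?_⟩
  simp only [mix, Fintype.sum_prod_type, ← Finset.mul_sum, hP.2, mul_one, hl.2]

theorem prob_mix (E : T × Ω → Prop) :
    prob (mix l P) E = ∑ t, l t * prob P (fun ω => E (t, ω)) := by
  classical
  simp only [prob_eq_sum, Fintype.sum_prod_type, mix, Finset.mul_sum, mul_ite, mul_zero]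

theorem prob_mix_and (t₀ : T) (E : T × Ω → Prop) :
    prob (mix l P) (fun z => z.1 = t₀ ∧ E z) = l t₀ * prob P (fun ω => E (t₀, ω)) := by
  classical
  rw [prob_mix, Finset.sum_eq_single t₀]
  · simp
  · intro t _ h
    rw [prob_eq_zero (by simp [h]), mul_zero]
  · simp

/-- The chain rule H(T, A) = H(T) + H(A | T), with T independent of the rest of the sample; the term
H(T) cancels in conditional entropies. -/
theorem entropy_mix (hP : P ∈ stdSimplex ℝ Ω) (A : T → Ω → α) :
    entropy (mix l P) (fun z => (z.1, A z.1 z.2)) =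
      (∑ t, Real.negMulLog (l t) / Real.log 2) + ∑ t, l t * entropy P (A t) := by
  unfold entropy
  rw [Fintype.sum_prod_type, ← Finset.sum_add_distrib]
  refine Finset.sum_congr rfl fun t _ => ?_
  simp only [Prod.mk.injEq, prob_mix_and, Real.negMulLog_mul]
  rw [← Finset.sum_div, ← Finset.sum_div, Finset.sum_add_distrib, ← Finset.sum_mul, sum_prob, hP.2,
    ← Finset.mul_sum]
  ring

theorem condEntropy_mix (hP : P ∈ stdSimplex ℝ Ω) (A : T → Ω → α) (C : T → Ω → γ)
    {D : T × Ω → δ} (hD : ∀ z z', D z' = D z ↔ (z'.1 = z.1 ∧ C z'.1 z'.2 = C z.1 z.2)) :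
    condEntropy (mix l P) (fun z => A z.1 z.2) D = ∑ t, l t * condEntropy P (A t) (C t) := by
  unfold condEntropy
  rw [entropy_congr (A := D) (B := fun z : T × Ω => (z.1, C z.1 z.2))
      fun z z' => by simpa using hD z z',
    entropy_congr (A := fun z => (A z.1 z.2, D z))
      (B := fun z : T × Ω => (z.1, (A z.1 z.2, C z.1 z.2)))
      fun z z' => by simp [hD z z']; tauto, entropy_mix hP C,
    entropy_mix hP (fun t ω => (A t ω, C t ω))]
  simp only [mul_sub, Finset.sum_sub_distrib]
  ring

/-- Concavity of entropy, as H(A | T) ≤ H(A). -/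
theorem sum_entropy_le_entropy_mix (hl : l ∈ stdSimplex ℝ T) (hP : P ∈ stdSimplex ℝ Ω)
    (A : T → Ω → α) :
    ∑ t, l t * entropy P (A t) ≤ entropy (mix l P) (fun z => A z.1 z.2) := by
  have h := condEntropy_le_entropy (mix_mem hl hP) (fun z => A z.1 z.2) (fun z : T × Ω => z.1)
  rw [condEntropy_mix hP A (fun _ _ => ()) (by simp)] at h
  refine le_trans (le_of_eq (Finset.sum_congr rfl fun t _ => ?_)) h
  rw [condEntropy, entropy_unit hP, sub_zero]
  exact congrArg _ (entropy_congr fun ω ω' => by simp)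

end Relabelling

/-! ### Realizing auxiliary variables by laws of the form P_{W,U,V} P_{X|U,V} -/

section Realization

/-- The value `b`, or nothing, according to the switch `s`. -/
def keep {B : Type*} (s : Bool) (b : B) : Option B := if s then some b else none

@[simp] theorem keep_true {B : Type*} (b : B) : keep true b = some b := rfl
@[simp] theorem keep_false {B : Type*} (b : B) : keep false b = none := rfl

/-- If `w` is a function of `u`, then `x` can be generated from `(u, v)` without changing the joint
law of `(w, u, v, x)`. -/
theorem exists_kernel {ζ A B C X : Type*} [Fintype ζ] [Fintype X] [Nonempty X] {r : ζ → ℝ} (hr : r ∈ stdSimplex ℝ ζ)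
    (w : ζ → A) (u : ζ → B) (v : ζ → C) (x : ζ → X) (hw : ∀ z z', u z' = u z → w z' = w z) :
    ∃ K : B × C → X → ℝ, (∀ s, K s ∈ stdSimplex ℝ X) ∧ ∀ a b c x₀,
      prob r (fun z => (w z, u z, v z) = (a, b, c)) * K (b, c) x₀ =
        prob r (fun z => (w z, u z, v z, x z) = (a, b, c, x₀)) := by
  classical
  set q : B × C → ℝ := fun s => prob r fun z => (u z, v z) = s with hq
  -- The kernel is the conditional law of x given (u, v), with an arbitrary point mass where (u, v)
  -- has probability zero.
  refine ⟨fun s => if q s = 0 then Pi.single (Classical.arbitrary X) 1 else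
    fun x₀ => prob r (fun z => (u z, v z) = s ∧ x z = x₀) / q s, fun s => ?_, fun a b c x₀ => ?_⟩
  · by_cases h : q s = 0
    · simp only [h, if_true]
      exact single_mem_stdSimplex ℝ _
    · simp only [h, if_false]
      refine ⟨fun x₀ => div_nonneg (prob_nonneg hr.1 _) (prob_nonneg hr.1 _), ?_⟩
      rw [← Finset.sum_div, sum_prob_and, div_self h]
  · by_cases h : prob r (fun z => (w z, u z, v z) = (a, b, c)) = 0
    · rw [h, zero_mul]
      refine le_antisymm (prob_nonneg hr.1 _) (h ▸ prob_mono hr.1 fun z hz => ?_)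
      simp only [Prod.mk.injEq] at hz ⊢
      tauto
    · obtain ⟨z₀, hz₀⟩ : ∃ z, (w z, u z, v z) = (a, b, c) := by
        by_contra hne
        exact h (prob_eq_zero fun z hz => hne ⟨z, hz⟩)
      simp only [Prod.mk.injEq] at hz₀
      -- On an attained triple, the event u = b forces w = a, so conditioning on (w, u, v) is
      -- conditioning on (u, v).
      have hwu : ∀ z, u z = b → w z = a := fun z hz => by
        rw [← hz₀.1]; exact hw z₀ z (hz.trans hz₀.2.1.symm)
      have h1 : prob r (fun z => (w z, u z, v z) = (a, b, c)) = q (b, c) :=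
        prob_congr fun z => by
          have := hwu z
          simp only [Prod.mk.injEq]; tauto
      rw [h1] at h ⊢
      simp only [h, if_false]
      rw [mul_div_cancel₀ _ h]
      exact prob_congr fun z => by
        have := hwu z
        simp only [Prod.mk.injEq]; tauto

variable {Ω ζ A B C T X Y₁ Y₂ : Type*} [Fintype Ω] [Fintype ζ] [Fintype A] [Fintype B] [Fintype C]
  [Fintype T] [Fintype X] [Fintype Y₁] [Fintype Y₂]

/-- The single-letter information quantities of `p` in terms of conditional entropies: `e₁ i j` stands
for `H(Y₁ | W, [U], [V])`, where the switches `i` and `j` tell whether `U` and `V` are present, and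
`k₁` is at most `H(Y₁)`; likewise for `e₂`, `k₂` and `Y₂`. -/
structure HasProfile {a b c : ℕ} (p : Letters a b c X Y₁ Y₂ → ℝ) (k₁ k₂ : ℝ)
    (e₁ e₂ : Bool → Bool → ℝ) : Prop where
  w₁ : k₁ - e₁ false false ≤
    mutualInfo p (fun (w, _, _, _, _, _) => w) (fun (_, _, _, _, y₁, _) => y₁)
  w₂ : k₂ - e₂ false false ≤
    mutualInfo p (fun (w, _, _, _, _, _) => w) (fun (_, _, _, _, _, y₂) => y₂)
  u₁ : infoU1 p = e₁ false false - e₁ true false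
  u₂ : infoU2 p = e₂ false false - e₂ true false
  v₁ : infoV1 p = e₁ false false - e₁ false true
  v₂ : infoV2 p = e₂ false false - e₂ false true
  u₁v : infoU1V p = e₁ false true - e₁ true true
  u₂v : infoU2V p = e₂ false true - e₂ true true
  v₁u : infoV1U p = e₁ true false - e₁ true true
  v₂u : infoV2U p = e₂ true false - e₂ true true

theorem HasProfile.minInfoW_ge {a b c : ℕ} {p : Letters a b c X Y₁ Y₂ → ℝ} {k₁ k₂ : ℝ}
    {e₁ e₂ : Bool → Bool → ℝ} (h : HasProfile p k₁ k₂ e₁ e₂) {s : ℝ}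
    (h₁ : s ≤ k₁ - e₁ false false) (h₂ : s ≤ k₂ - e₂ false false) : s ≤ minInfoW p :=
  le_min (h₁.trans h.w₁) (h₂.trans h.w₂)

/-- The profile of a joint law in which `f` collects the six variables. -/
theorem hasProfile_push {a b c : ℕ} {P : Ω → ℝ} {f : Ω → Letters a b c X Y₁ Y₂}
    {w : Ω → A} {u : Ω → B} {v : Ω → C}
    (hw : ∀ ω ω', (f ω').1 = (f ω).1 ↔ w ω' = w ω)
    (hu : ∀ ω ω', ((f ω').2.1 = (f ω).2.1 ∧ (f ω').1 = (f ω).1) ↔ (u ω' = u ω ∧ w ω' = w ω))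
    (hv : ∀ ω ω', (f ω').2.2.1 = (f ω).2.2.1 ↔ v ω' = v ω) :
    HasProfile (push P f) (entropy P fun ω => (f ω).2.2.2.2.1) (entropy P fun ω => (f ω).2.2.2.2.2)
      (fun i j => condEntropy P (fun ω => (f ω).2.2.2.2.1)
        fun ω => (w ω, keep i (u ω), keep j (v ω)))
      (fun i j => condEntropy P (fun ω => (f ω).2.2.2.2.2)
        fun ω => (w ω, keep i (u ω), keep j (v ω))) where
  w₁ := by rw [mutualInfo_push]; exact (mutualInfo_eq_sub fun ω ω' => by simp [hw ω ω']).ge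
  w₂ := by rw [mutualInfo_push]; exact (mutualInfo_eq_sub fun ω ω' => by simp [hw ω ω']).ge
  u₁ := by
    rw [infoU1, condMutualInfo_push]
    exact condMutualInfo_eq_sub (fun ω ω' => by simp [hw ω ω'])
      (fun ω ω' => by simpa [and_comm] using hu ω ω')
  u₂ := by
    rw [infoU2, condMutualInfo_push]
    exact condMutualInfo_eq_sub (fun ω ω' => by simp [hw ω ω'])
      (fun ω ω' => by simpa [and_comm] using hu ω ω')
  v₁ := by
    rw [infoV1, condMutualInfo_push]
    exact condMutualInfo_eq_sub (fun ω ω' => by simp [hw ω ω'])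
      (fun ω ω' => by simp [hv ω ω', hw ω ω', and_comm])
  v₂ := by
    rw [infoV2, condMutualInfo_push]
    exact condMutualInfo_eq_sub (fun ω ω' => by simp [hw ω ω'])
      (fun ω ω' => by simp [hv ω ω', hw ω ω', and_comm])
  u₁v := by
    rw [infoU1V, condMutualInfo_push]
    exact condMutualInfo_eq_sub (fun ω ω' => by simp [hw ω ω', hv ω ω'])
      (fun ω ω' => by have := hu ω ω'; have := hv ω ω'; simp; tauto)
  u₂v := by
    rw [infoU2V, condMutualInfo_push]
    exact condMutualInfo_eq_sub (fun ω ω' => by simp [hw ω ω', hv ω ω'])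
      (fun ω ω' => by have := hu ω ω'; have := hv ω ω'; simp; tauto)
  v₁u := by
    rw [infoV1U, condMutualInfo_push]
    exact condMutualInfo_eq_sub (fun ω ω' => by have := hu ω ω'; simp; tauto)
      (fun ω ω' => by have := hu ω ω'; have := hv ω ω'; simp; tauto)
  v₂u := by
    rw [infoV2U, condMutualInfo_push]
    exact condMutualInfo_eq_sub (fun ω ω' => by have := hu ω ω'; simp; tauto)
      (fun ω ω' => by have := hu ω ω'; have := hv ω ω'; simp; tauto)

variable {Q : X → Y₁ × Y₂ → ℝ}

/-- Auxiliary variables `w, u, v` that are functions of a hidden state `Z` which, with the channel,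
determines the law of the outputs, can be replaced by letters as in `outerRegion`. -/
theorem exists_inputLaw (hQ : ∀ x, Q x ∈ stdSimplex ℝ (Y₁ × Y₂)) {P : Ω → ℝ}
    (hP : P ∈ stdSimplex ℝ Ω) (Z : Ω → ζ) (w : ζ → A) (u : ζ → B) (v : ζ → C) (x : ζ → X)
    (y₁ : Ω → Y₁) (y₂ : Ω → Y₂) (r : ζ → ℝ)
    (hr : ∀ z b₁ b₂, prob P (fun ω => Z ω = z ∧ y₁ ω = b₁ ∧ y₂ ω = b₂) = r z * Q (x z) (b₁, b₂)) :
    ∃ (a b c : ℕ) (P' : Fin a × Fin b × Fin c → ℝ) (K : Fin b × Fin c → X → ℝ),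
      P' ∈ stdSimplex ℝ (Fin a × Fin b × Fin c) ∧ (∀ s, K s ∈ stdSimplex ℝ X) ∧
      HasProfile (jointLaw (inputLaw P' K) Q) (entropy P y₁) (entropy P y₂)
        (fun i j => condEntropy P y₁ fun ω => (w (Z ω), keep i (u (Z ω)), keep j (v (Z ω))))
        (fun i j => condEntropy P y₂ fun ω => (w (Z ω), keep i (u (Z ω)), keep j (v (Z ω)))) := by
  classical
  -- Summing the hypothesis over the outputs shows that `r` is the law of the hidden state.
  have hr' : push P Z = r := by
    funext z
    have h1 : push P Z z =
        ∑ s : Y₁ × Y₂, prob P (fun ω => Z ω = z ∧ (y₁ ω, y₂ ω) = s) := by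
      rw [sum_prob_and]; rfl
    rw [h1]
    calc ∑ s : Y₁ × Y₂, prob P (fun ω => Z ω = z ∧ (y₁ ω, y₂ ω) = s)
        = ∑ s : Y₁ × Y₂, r z * Q (x z) s := Finset.sum_congr rfl fun s _ => by
          rw [← hr z s.1 s.2]
          exact prob_congr fun ω => by rw [Prod.ext_iff]
      _ = r z := by rw [← Finset.mul_sum, (hQ _).2, mul_one]
  have hrm : r ∈ stdSimplex ℝ ζ := hr' ▸ push_mem hP Z
  obtain ⟨z₀⟩ : Nonempty ζ := by
    by_contra h
    rw [not_nonempty_iff] at h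
    simpa using hrm.2
  have : Nonempty X := ⟨x z₀⟩
  let eA := Fintype.equivFin A
  -- The new U is the pair (W, U), so that W is a function of it as `exists_kernel` requires.
  let eB := Fintype.equivFin (A × B)
  let eC := Fintype.equivFin C
  obtain ⟨K, hK, hKr⟩ := exists_kernel hrm (fun z => eA (w z)) (fun z => eB (w z, u z))
    (fun z => eC (v z)) x (fun z z' h => by simp at h; simp [h.1])
  refine ⟨_, _, _, push r fun z => (eA (w z), eB (w z, u z), eC (v z)), K, push_mem hrm _, hK, ?_⟩
  have hlaw : jointLaw (inputLaw (push r fun z => (eA (w z), eB (w z, u z), eC (v z))) K) Q =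
      push P fun ω => (eA (w (Z ω)), eB (w (Z ω), u (Z ω)), eC (v (Z ω)), x (Z ω), y₁ ω, y₂ ω) := by
    funext ⟨a, b, c, x₀, b₁, b₂⟩
    simp only [jointLaw, inputLaw, push]
    rw [hKr]
    have h1 : ∀ ω, ((eA (w (Z ω)), eB (w (Z ω), u (Z ω)), eC (v (Z ω)), x (Z ω), y₁ ω, y₂ ω) =
        (a, b, c, x₀, b₁, b₂)) ↔
        ((eA (w (Z ω)), eB (w (Z ω), u (Z ω)), eC (v (Z ω)), x (Z ω)) = (a, b, c, x₀) ∧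
          y₁ ω = b₁ ∧ y₂ ω = b₂) := fun ω => by simp only [Prod.mk.injEq]; tauto
    -- The event is split over the hidden states. All states that contribute have the same input x₀,
    -- so the channel factor is common to them.
    rw [prob_congr h1, ← sum_prob_and Z, prob_eq_sum, Finset.sum_mul]
    refine Finset.sum_congr rfl fun z _ => ?_
    split_ifs with h
    · simp only [Prod.mk.injEq] at h
      rw [← h.2.2.2, ← hr]
      refine prob_congr fun ω => ?_
      constructor
      · rintro ⟨rfl, h2⟩
        simp [h, h2]
      · rintro ⟨⟨-, h2⟩, rfl⟩
        exact ⟨rfl, h2⟩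
    · rw [zero_mul, prob_eq_zero]
      rintro ω ⟨⟨h2, -⟩, rfl⟩
      exact h h2
  rw [hlaw]
  exact hasProfile_push (w := fun ω => w (Z ω)) (u := fun ω => u (Z ω)) (v := fun ω => v (Z ω))
    (by simp) (by simp; tauto) (by simp)

/-- Time sharing over `T`: the conditional entropies are averaged. The switches `su` and `sv` allow to
drop the auxiliary variables `U` and `V`. -/
theorem exists_inputLaw_timeSharing (hQ : ∀ x, Q x ∈ stdSimplex ℝ (Y₁ × Y₂)) {l : T → ℝ}
    (hl : l ∈ stdSimplex ℝ T) {P : Ω → ℝ} (hP : P ∈ stdSimplex ℝ Ω) (Z : T → Ω → ζ)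
    (w : T → ζ → A) (u : T → ζ → B) (v : T → ζ → C) (x : T → ζ → X)
    (y₁ : T → Ω → Y₁) (y₂ : T → Ω → Y₂) (r : T → ζ → ℝ)
    (hr : ∀ t z b₁ b₂, prob P (fun ω => Z t ω = z ∧ y₁ t ω = b₁ ∧ y₂ t ω = b₂) =
      r t z * Q (x t z) (b₁, b₂)) (su sv : Bool) :
    ∃ (a b c : ℕ) (P' : Fin a × Fin b × Fin c → ℝ) (K : Fin b × Fin c → X → ℝ),
      P' ∈ stdSimplex ℝ (Fin a × Fin b × Fin c) ∧ (∀ s, K s ∈ stdSimplex ℝ X) ∧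
      HasProfile (jointLaw (inputLaw P' K) Q)
        (∑ t, l t * entropy P (y₁ t)) (∑ t, l t * entropy P (y₂ t))
        (fun i j => ∑ t, l t * condEntropy P (y₁ t) fun ω =>
          (w t (Z t ω), keep (i && su) (u t (Z t ω)), keep (j && sv) (v t (Z t ω))))
        (fun i j => ∑ t, l t * condEntropy P (y₂ t) fun ω =>
          (w t (Z t ω), keep (i && su) (u t (Z t ω)), keep (j && sv) (v t (Z t ω)))) := by
  -- The time-sharing variable joins both the hidden state and W.
  obtain ⟨a, b, c, P', K, hP', hK, h⟩ := exists_inputLaw (Q := Q) hQ (mix_mem hl hP)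
    (fun s => (s.1, Z s.1 s.2)) (fun s => (s.1, w s.1 s.2)) (fun s => keep su (u s.1 s.2))
    (fun s => keep sv (v s.1 s.2)) (fun s => x s.1 s.2) (fun s => y₁ s.1 s.2)
    (fun s => y₂ s.1 s.2) (fun s => l s.1 * r s.1 s.2) (by
      rintro ⟨t, z⟩ b₁ b₂
      rw [mul_assoc, ← hr, ← prob_mix_and t
        (fun s => Z s.1 s.2 = z ∧ y₁ s.1 s.2 = b₁ ∧ y₂ s.1 s.2 = b₂)]
      exact prob_congr fun s => by simp only [Prod.mk.injEq]; tauto)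
  refine ⟨a, b, c, P', K, hP', hK, ?_⟩
  have hD : ∀ i j, ∀ s s' : T × Ω,
      ((s'.1, w s'.1 (Z s'.1 s'.2)), keep i (keep su (u s'.1 (Z s'.1 s'.2))),
        keep j (keep sv (v s'.1 (Z s'.1 s'.2)))) =
      ((s.1, w s.1 (Z s.1 s.2)), keep i (keep su (u s.1 (Z s.1 s.2))),
        keep j (keep sv (v s.1 (Z s.1 s.2)))) ↔ (s'.1 = s.1 ∧
      (w s'.1 (Z s'.1 s'.2), keep (i && su) (u s'.1 (Z s'.1 s'.2)),
        keep (j && sv) (v s'.1 (Z s'.1 s'.2))) =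
      (w s.1 (Z s.1 s.2), keep (i && su) (u s.1 (Z s.1 s.2)),
        keep (j && sv) (v s.1 (Z s.1 s.2)))) := by
    intro i j s s'
    cases i <;> cases j <;> cases su <;> cases sv <;> simp [and_assoc]
  have e₁ : ∀ i j, _ = _ := fun i j => condEntropy_mix (l := l) hP y₁
    (fun t ω => (w t (Z t ω), keep (i && su) (u t (Z t ω)), keep (j && sv) (v t (Z t ω)))) (hD i j)
  have e₂ : ∀ i j, _ = _ := fun i j => condEntropy_mix (l := l) hP y₂
    (fun t ω => (w t (Z t ω), keep (i && su) (u t (Z t ω)), keep (j && sv) (v t (Z t ω)))) (hD i j)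
  simp only [e₁, e₂] at h
  -- Only I(W; Y_j) involves an unconditional entropy, and there the average is a lower bound.
  exact { h with
    w₁ := (sub_le_sub_right (sum_entropy_le_entropy_mix hl hP y₁) _).trans h.w₁
    w₂ := (sub_le_sub_right (sum_entropy_le_entropy_mix hl hP y₂) _).trans h.w₂ }

end Realization

/-! ### Single-letter regions: removal of the leakage bounds, convexity -/

section SingleLetter

variable {X Y₁ Y₂ : Type*} [Fintype X] [Fintype Y₁] [Fintype Y₂] {Q : X → Y₁ × Y₂ → ℝ}
  {a b c a' b' c' : ℕ}

/-- The letters `(W, U, V, X)`. -/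
def inputPart (s : Letters a b c X Y₁ Y₂) : Fin a × Fin b × Fin c × X :=
  (s.1, s.2.1, s.2.2.1, s.2.2.2.1)

theorem prob_jointLaw_and (P : Fin a × Fin b × Fin c × X → ℝ) (z : Fin a × Fin b × Fin c × X)
    (b₁ : Y₁) (b₂ : Y₂) :
    prob (jointLaw P Q) (fun s => inputPart s = z ∧ s.2.2.2.2.1 = b₁ ∧ s.2.2.2.2.2 = b₂) =
      P z * Q z.2.2.2 (b₁, b₂) := by
  obtain ⟨w, u, v, x⟩ := z
  rw [prob_eq_single (w, u, v, x, b₁, b₂)]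
  · rfl
  · rintro ⟨w', u', v', x', y₁, y₂⟩
    simp only [inputPart, Prod.mk.injEq]
    tauto

theorem prob_jointLaw_inputPart (hQ : ∀ x, Q x ∈ stdSimplex ℝ (Y₁ × Y₂))
    (P : Fin a × Fin b × Fin c × X → ℝ) (z : Fin a × Fin b × Fin c × X) :
    prob (jointLaw P Q) (fun s => inputPart s = z) = P z := by
  rw [← sum_prob_and (fun s : Letters a b c X Y₁ Y₂ => s.2.2.2.2)]
  calc ∑ t : Y₁ × Y₂, prob (jointLaw P Q) (fun s => inputPart s = z ∧ s.2.2.2.2 = t)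
      = ∑ t : Y₁ × Y₂, P z * Q z.2.2.2 t := Finset.sum_congr rfl fun t _ => by
        rw [← prob_jointLaw_and P z t.1 t.2]
        exact prob_congr fun s => by rw [Prod.ext_iff (x := s.2.2.2.2)]
    _ = P z := by rw [← Finset.mul_sum, (hQ _).2, mul_one]

theorem jointLaw_mem (hQ : ∀ x, Q x ∈ stdSimplex ℝ (Y₁ × Y₂))
    {P : Fin a × Fin b × Fin c × X → ℝ} (hP : P ∈ stdSimplex ℝ (Fin a × Fin b × Fin c × X)) :
    jointLaw P Q ∈ stdSimplex ℝ (Letters a b c X Y₁ Y₂) := by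
  refine ⟨fun s => mul_nonneg (hP.1 _) ((hQ _).1 _), ?_⟩
  rw [← sum_prob inputPart]
  simp only [prob_jointLaw_inputPart hQ, hP.2]

theorem inputLaw_mem {P : Fin a × Fin b × Fin c → ℝ} {K : Fin b × Fin c → X → ℝ}
    (hP : P ∈ stdSimplex ℝ (Fin a × Fin b × Fin c)) (hK : ∀ s, K s ∈ stdSimplex ℝ X) :
    inputLaw P K ∈ stdSimplex ℝ (Fin a × Fin b × Fin c × X) := by
  refine ⟨fun s => mul_nonneg (hP.1 _) ((hK _).1 _), ?_⟩
  have h := hP.2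
  simp only [Fintype.sum_prod_type] at h ⊢
  simpa only [inputLaw, ← Finset.mul_sum, (hK _).2, mul_one] using h

/-- `H(Y₁ | W, [U], [V])`. -/
noncomputable def letterEntropy₁ (p : Letters a b c X Y₁ Y₂ → ℝ) (i j : Bool) : ℝ :=
  condEntropy p (fun s => s.2.2.2.2.1) fun s => (s.1, keep i s.2.1, keep j s.2.2.1)

/-- `H(Y₂ | W, [U], [V])`. -/
noncomputable def letterEntropy₂ (p : Letters a b c X Y₁ Y₂ → ℝ) (i j : Bool) : ℝ :=
  condEntropy p (fun s => s.2.2.2.2.2) fun s => (s.1, keep i s.2.1, keep j s.2.2.1)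

theorem push_id (p : Letters a b c X Y₁ Y₂ → ℝ) : push p id = p :=
  funext fun s => prob_eq_single s fun _ => Iff.rfl

theorem hasProfile_self (p : Letters a b c X Y₁ Y₂ → ℝ) :
    HasProfile p (entropy p fun s => s.2.2.2.2.1) (entropy p fun s => s.2.2.2.2.2)
      (letterEntropy₁ p) (letterEntropy₂ p) := by
  have h := hasProfile_push (P := p) (f := id) (w := fun s => s.1) (u := fun s => s.2.1)
    (v := fun s => s.2.2.1) (by simp) (by simp) (by simp)
  rwa [push_id] at h

/-- A profile bounds I(W; Y_j) only from below, which is what a newly constructed law needs; for the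
law one starts from, the opposite inequality is needed. -/
theorem minInfoW_le₁ (p : Letters a b c X Y₁ Y₂ → ℝ) :
    minInfoW p ≤ (entropy p fun s => s.2.2.2.2.1) - letterEntropy₁ p false false :=
  (min_le_left _ _).trans (mutualInfo_eq_sub fun s s' => by simp).le

theorem minInfoW_le₂ (p : Letters a b c X Y₁ Y₂ → ℝ) :
    minInfoW p ≤ (entropy p fun s => s.2.2.2.2.2) - letterEntropy₂ p false false :=
  (min_le_right _ _).trans (mutualInfo_eq_sub fun s s' => by simp).le

/-- The rate triples of `outerRegion` before taking the closure. -/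
def outerSet (Q : X → Y₁ × Y₂ → ℝ) (L₁ L₂ : ℝ) : Set (ℝ × ℝ × ℝ) :=
  {R | ∃ (a b c : ℕ) (P : Fin a × Fin b × Fin c → ℝ) (K : Fin b × Fin c → X → ℝ),
    P ∈ stdSimplex ℝ (Fin a × Fin b × Fin c) ∧ (∀ uv, K uv ∈ stdSimplex ℝ X) ∧
    RateBounds (jointLaw (inputLaw P K) Q) R.1 R.2.1 R.2.2 ∧
    LeakageBounds (jointLaw (inputLaw P K) Q) L₁ L₂ R.2.1 R.2.2}

/-- The letters (W, U, V, X) themselves serve as hidden state, and the realization replaces U by (W,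
U) without decreasing any right-hand side. -/
theorem outerRegionInactive_eq_uvwRegion (hQ : ∀ x, Q x ∈ stdSimplex ℝ (Y₁ × Y₂)) :
    outerRegionInactive Q = uvwRegion Q := by
  refine congrArg closure (Set.ext fun R => ⟨?_, ?_⟩)
  · rintro ⟨a, b, c, P, K, hP, hK, h⟩
    exact ⟨a, b, c, _, inputLaw_mem hP hK, h⟩
  · rintro ⟨a, b, c, P, hP, h⟩
    obtain ⟨a', b', c', P', K, hP', hK, h'⟩ := exists_inputLaw hQ (jointLaw_mem hQ hP)
      inputPart (fun z => z.1) (fun z => z.2.1) (fun z => z.2.2.1) (fun z => z.2.2.2)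
      (fun s => s.2.2.2.2.1) (fun s => s.2.2.2.2.2) P (prob_jointLaw_and P)
    refine ⟨a', b', c', P', K, hP', hK, ?_⟩
    have hp := hasProfile_self (jointLaw P Q)
    have hm := h'.minInfoW_ge (minInfoW_le₁ (jointLaw P Q)) (minInfoW_le₂ (jointLaw P Q))
    have e₁ := h'.u₁.trans hp.u₁.symm
    have e₂ := h'.v₂.trans hp.v₂.symm
    have e₃ := h'.u₁v.trans hp.u₁v.symm
    have e₄ := h'.v₂u.trans hp.v₂u.symm
    obtain ⟨h1, h2, h3, h4, h5, h6, h7, h8⟩ := h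
    constructor <;> linarith

theorem mutualInfo_le_log_card {Ω α β : Type*} [Fintype Ω] [Fintype α] [Fintype β] {P : Ω → ℝ}
    (hP : P ∈ stdSimplex ℝ Ω) (A : Ω → α) (B : Ω → β) :
    mutualInfo P A B ≤ Real.log (Fintype.card β) / Real.log 2 := by
  rw [mutualInfo_eq_sub (D := A) fun _ _ => Iff.rfl]
  have := condEntropy_nonneg hP B A
  have := entropy_le_log_card hP B
  linarith

theorem condMutualInfo_le_log_card {Ω α β γ : Type*} [Fintype Ω] [Fintype α] [Fintype β]
    [Fintype γ] {P : Ω → ℝ} (hP : P ∈ stdSimplex ℝ Ω) (A : Ω → α) (B : Ω → β) (C : Ω → γ) :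
    condMutualInfo P A B C ≤ Real.log (Fintype.card β) / Real.log 2 := by
  rw [condMutualInfo_eq_sub (C' := C) (D := fun ω => (A ω, C ω)) (fun _ _ => Iff.rfl) (by simp)]
  have := condEntropy_nonneg hP B (fun ω => (A ω, C ω))
  have := entropy_le_log_card hP B
  have := condEntropy_le_entropy hP B C
  linarith

/-- The rate bounds already give R_j ≤ 2 log|Y_j|, and each subtracted information is at most the
log-cardinality of the other output. The common threshold 2 log|Y₁| + 2 log|Y₂| covers both
receivers. -/
theorem leakageBounds_of_rateBounds {p : Letters a b c X Y₁ Y₂ → ℝ}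
    (hp : p ∈ stdSimplex ℝ (Letters a b c X Y₁ Y₂)) {L₁ L₂ R₀ R₁ R₂ : ℝ}
    (hL₁ : 2 * (Real.log (Fintype.card Y₁) / Real.log 2) +
      2 * (Real.log (Fintype.card Y₂) / Real.log 2) ≤ L₁)
    (hL₂ : 2 * (Real.log (Fintype.card Y₁) / Real.log 2) +
      2 * (Real.log (Fintype.card Y₂) / Real.log 2) ≤ L₂)
    (h : RateBounds p R₀ R₁ R₂) : LeakageBounds p L₁ L₂ R₁ R₂ := by
  have c₁ : 0 ≤ Real.log (Fintype.card Y₁) / Real.log 2 :=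
    div_nonneg (Real.log_natCast_nonneg _) log_two_pos.le
  have c₂ : 0 ≤ Real.log (Fintype.card Y₂) / Real.log 2 :=
    div_nonneg (Real.log_natCast_nonneg _) log_two_pos.le
  have m₁ : minInfoW p ≤ _ := (min_le_left _ _).trans (mutualInfo_le_log_card hp _ _)
  have m₂ : minInfoW p ≤ _ := (min_le_right _ _).trans (mutualInfo_le_log_card hp _ _)
  have u₁ : infoU1 p ≤ _ := condMutualInfo_le_log_card hp _ _ _
  have u₂ : infoU2 p ≤ _ := condMutualInfo_le_log_card hp _ _ _
  have u₂v : infoU2V p ≤ _ := condMutualInfo_le_log_card hp _ _ _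
  have v₁ : infoV1 p ≤ _ := condMutualInfo_le_log_card hp _ _ _
  have v₂ : infoV2 p ≤ _ := condMutualInfo_le_log_card hp _ _ _
  have v₁u : infoV1U p ≤ _ := condMutualInfo_le_log_card hp _ _ _
  have n₁ : 0 ≤ infoU1 p := condMutualInfo_nonneg hp _ _ _
  have n₂ : 0 ≤ infoU1V p := condMutualInfo_nonneg hp _ _ _
  have n₃ : 0 ≤ infoV2 p := condMutualInfo_nonneg hp _ _ _
  have n₄ : 0 ≤ infoV2U p := condMutualInfo_nonneg hp _ _ _
  obtain ⟨h1, h2, h3, h4, h5, h6, h7, h8⟩ := h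
  constructor <;> linarith

theorem outerRegion_eq_outerRegionInactive (hQ : ∀ x, Q x ∈ stdSimplex ℝ (Y₁ × Y₂)) {L₁ L₂ : ℝ}
    (hL₁ : 2 * (Real.log (Fintype.card Y₁) / Real.log 2) +
      2 * (Real.log (Fintype.card Y₂) / Real.log 2) ≤ L₁)
    (hL₂ : 2 * (Real.log (Fintype.card Y₁) / Real.log 2) +
      2 * (Real.log (Fintype.card Y₂) / Real.log 2) ≤ L₂) :
    outerRegion Q L₁ L₂ = outerRegionInactive Q := by
  refine congrArg closure (Set.ext fun R => ⟨?_, ?_⟩)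
  · rintro ⟨a, b, c, P, K, hP, hK, h, -⟩
    exact ⟨a, b, c, P, K, hP, hK, h⟩
  · rintro ⟨a, b, c, P, K, hP, hK, h⟩
    exact ⟨a, b, c, P, K, hP, hK, h,
      leakageBounds_of_rateBounds (jointLaw_mem hQ (inputLaw_mem hP hK)) hL₁ hL₂ h⟩

theorem prob_mix_prod {T Ω : Type*} [Fintype T] [Fintype Ω] {l : T → ℝ} {P : Ω → ℝ}
    (A : T → Prop) (B : Ω → Prop) :
    prob (mix l P) (fun z => A z.1 ∧ B z.2) = prob l A * prob P B := by
  classical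
  rw [prob_mix, prob_eq_sum A, Finset.sum_mul]
  refine Finset.sum_congr rfl fun t _ => ?_
  by_cases h : A t <;> simp [h, prob_eq_zero]

theorem push_mix_fst {T Ω : Type*} [Fintype T] [Fintype Ω] {l : T → ℝ} {P : Ω → ℝ}
    (hP : P ∈ stdSimplex ℝ Ω) : push (mix l P) Prod.fst = l := by
  funext t
  have h := prob_mix_prod (l := l) (P := P) (fun s => s = t) (fun _ => True)
  rw [prob_eq_single t fun _ => Iff.rfl] at h
  rw [prob_congr fun z => iff_of_eq (and_true _)] at h
  simpa [push, prob, hP.2] using h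

theorem push_mix_snd {T Ω : Type*} [Fintype T] [Fintype Ω] {l : T → ℝ} {P : Ω → ℝ}
    (hl : l ∈ stdSimplex ℝ T) : push (mix l P) Prod.snd = P := by
  funext ω
  have h := prob_mix_prod (l := l) (P := P) (fun _ => True) (fun s => s = ω)
  rw [prob_eq_single (P := P) ω fun _ => Iff.rfl] at h
  rw [prob_congr fun z => iff_of_eq (true_and _)] at h
  simpa [push, prob, hl.2] using h

/-- Time sharing between two laws of the letters. -/
theorem exists_inputLaw_mix (hQ : ∀ x, Q x ∈ stdSimplex ℝ (Y₁ × Y₂))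
    {P : Fin a × Fin b × Fin c × X → ℝ} (hP : P ∈ stdSimplex ℝ (Fin a × Fin b × Fin c × X))
    {P' : Fin a' × Fin b' × Fin c' × X → ℝ}
    (hP' : P' ∈ stdSimplex ℝ (Fin a' × Fin b' × Fin c' × X)) {s s' : ℝ} (hs : 0 ≤ s)
    (hs' : 0 ≤ s') (hss : s + s' = 1) :
    ∃ (k m n : ℕ) (P'' : Fin k × Fin m × Fin n → ℝ) (K : Fin m × Fin n → X → ℝ),
      P'' ∈ stdSimplex ℝ (Fin k × Fin m × Fin n) ∧ (∀ s, K s ∈ stdSimplex ℝ X) ∧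
      HasProfile (jointLaw (inputLaw P'' K) Q)
        (s * entropy (jointLaw P Q) (fun s => s.2.2.2.2.1) +
          s' * entropy (jointLaw P' Q) (fun s => s.2.2.2.2.1))
        (s * entropy (jointLaw P Q) (fun s => s.2.2.2.2.2) +
          s' * entropy (jointLaw P' Q) (fun s => s.2.2.2.2.2))
        (fun i j => s * letterEntropy₁ (jointLaw P Q) i j + s' * letterEntropy₁ (jointLaw P' Q) i j)
        (fun i j => s * letterEntropy₂ (jointLaw P Q) i j +
          s' * letterEntropy₂ (jointLaw P' Q) i j) := by
  have hp := jointLaw_mem hQ hP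
  have hp' := jointLaw_mem hQ hP'
  -- Both laws live on one sample space as independent components, and T selects the component to be
  -- read. The disjoint sums provide common alphabets for W, U and V.
  obtain ⟨k, m, n, P'', K, h1, h2, h3⟩ := exists_inputLaw_timeSharing (Q := Q) hQ
    (l := fun t : Bool => cond t s s')
    ⟨fun t => by cases t <;> simpa, by simpa [Fintype.sum_bool] using hss⟩
    (mix_mem hp hp') (fun _ ω => (inputPart ω.1, inputPart ω.2))
    (fun t z => cond t (Sum.inl z.1.1) (Sum.inr z.2.1))
    (fun t z => cond t (Sum.inl z.1.2.1) (Sum.inr z.2.2.1))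
    (fun t z => cond t (Sum.inl z.1.2.2.1) (Sum.inr z.2.2.2.1))
    (fun t z => cond t z.1.2.2.2 z.2.2.2.2)
    (fun t ω => cond t ω.1.2.2.2.2.1 ω.2.2.2.2.2.1)
    (fun t ω => cond t ω.1.2.2.2.2.2 ω.2.2.2.2.2.2)
    (fun _ z => P z.1 * P' z.2) (by
      rintro t ⟨z, z'⟩ b₁ b₂
      cases t
      · have h := prob_mix_prod (l := jointLaw P Q) (P := jointLaw P' Q)
          (fun ω => inputPart ω = z)
          (fun ω => inputPart ω = z' ∧ ω.2.2.2.2.1 = b₁ ∧ ω.2.2.2.2.2 = b₂)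
        rw [prob_jointLaw_inputPart hQ, prob_jointLaw_and] at h
        dsimp only [cond]
        rw [mul_assoc, ← h]
        exact prob_congr fun ω => by simp only [Prod.mk.injEq]; tauto
      · have h := prob_mix_prod (l := jointLaw P Q) (P := jointLaw P' Q)
          (fun ω => inputPart ω = z ∧ ω.2.2.2.2.1 = b₁ ∧ ω.2.2.2.2.2 = b₂)
          (fun ω => inputPart ω = z')
        rw [prob_jointLaw_inputPart hQ, prob_jointLaw_and] at h
        dsimp only [cond]
        rw [mul_right_comm, ← h]
        exact prob_congr fun ω => by simp only [Prod.mk.injEq]; tauto) true true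
  refine ⟨k, m, n, P'', K, h1, h2, ?_⟩
  simp only [Fintype.sum_bool, cond, Bool.and_true] at h3
  -- Entropies of one component may be computed under the product law, whose marginals are the two
  -- given laws.
  convert h3 using 1
  · nth_rewrite 1 [← push_mix_fst (l := jointLaw P Q) hp']
    nth_rewrite 2 [← push_mix_snd (P := jointLaw P' Q) hp]
    rw [entropy_push, entropy_push]
  · nth_rewrite 1 [← push_mix_fst (l := jointLaw P Q) hp']
    nth_rewrite 2 [← push_mix_snd (P := jointLaw P' Q) hp]
    rw [entropy_push, entropy_push]
  · funext i j
    unfold letterEntropy₁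
    nth_rewrite 1 [← push_mix_fst (l := jointLaw P Q) hp']
    nth_rewrite 2 [← push_mix_snd (P := jointLaw P' Q) hp]
    rw [condEntropy_push, condEntropy_push]
    congr 2 <;> refine condEntropy_congr (by simp) ?_ <;> cases i <;> cases j <;> simp [inputPart]
  · funext i j
    unfold letterEntropy₂
    nth_rewrite 1 [← push_mix_fst (l := jointLaw P Q) hp']
    nth_rewrite 2 [← push_mix_snd (P := jointLaw P' Q) hp]
    rw [condEntropy_push, condEntropy_push]
    congr 2 <;> refine condEntropy_congr (by simp) ?_ <;> cases i <;> cases j <;> simp [inputPart]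

theorem convex_outerSet (hQ : ∀ x, Q x ∈ stdSimplex ℝ (Y₁ × Y₂)) (L₁ L₂ : ℝ) :
    Convex ℝ (outerSet Q L₁ L₂) := by
  rintro ⟨R₀, R₁, R₂⟩ ⟨a, b, c, P, K, hP, hK, h, g⟩ ⟨R₀', R₁', R₂'⟩
    ⟨a', b', c', P', K', hP', hK', h', g'⟩ s s' hs hs' hss
  obtain ⟨k, m, n, P'', K'', h1, h2, h3⟩ :=
    exists_inputLaw_mix hQ (inputLaw_mem hP hK) (inputLaw_mem hP' hK') hs hs' hss
  set p := jointLaw (inputLaw P K) Q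
  set p' := jointLaw (inputLaw P' K') Q
  set p'' := jointLaw (inputLaw P'' K'') Q
  have hp := hasProfile_self p
  have hp' := hasProfile_self p'
  have hm : s * minInfoW p + s' * minInfoW p' ≤ minInfoW p'' := h3.minInfoW_ge
    (by linear_combination s * minInfoW_le₁ p + s' * minInfoW_le₁ p')
    (by linear_combination s * minInfoW_le₂ p + s' * minInfoW_le₂ p')
  have u₁ : infoU1 p'' = s * infoU1 p + s' * infoU1 p' := by
    rw [h3.u₁, hp.u₁, hp'.u₁]; ring
  have u₂ : infoU2 p'' = s * infoU2 p + s' * infoU2 p' := by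
    rw [h3.u₂, hp.u₂, hp'.u₂]; ring
  have v₁ : infoV1 p'' = s * infoV1 p + s' * infoV1 p' := by
    rw [h3.v₁, hp.v₁, hp'.v₁]; ring
  have v₂ : infoV2 p'' = s * infoV2 p + s' * infoV2 p' := by
    rw [h3.v₂, hp.v₂, hp'.v₂]; ring
  have u₁v : infoU1V p'' = s * infoU1V p + s' * infoU1V p' := by
    rw [h3.u₁v, hp.u₁v, hp'.u₁v]; ring
  have u₂v : infoU2V p'' = s * infoU2V p + s' * infoU2V p' := by
    rw [h3.u₂v, hp.u₂v, hp'.u₂v]; ring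
  have v₁u : infoV1U p'' = s * infoV1U p + s' * infoV1U p' := by
    rw [h3.v₁u, hp.v₁u, hp'.v₁u]; ring
  have v₂u : infoV2U p'' = s * infoV2U p + s' * infoV2U p' := by
    rw [h3.v₂u, hp.v₂u, hp'.v₂u]; ring
  refine ⟨k, m, n, P'', K'', h1, h2, ?_, ?_⟩
  · simp only [Prod.smul_mk, Prod.mk_add_mk, smul_eq_mul]
    constructor
    · linear_combination s * h.nonneg₀ + s' * h'.nonneg₀
    · linear_combination s * h.nonneg₁ + s' * h'.nonneg₁
    · linear_combination s * h.nonneg₂ + s' * h'.nonneg₂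
    · linear_combination s * h.bound₀ + s' * h'.bound₀ + hm
    · rw [u₁]; linear_combination s * h.bound₀₁ + s' * h'.bound₀₁ + hm
    · rw [v₂]; linear_combination s * h.bound₀₂ + s' * h'.bound₀₂ + hm
    · rw [u₁v, v₂]; linear_combination s * h.bound_sum₁ + s' * h'.bound_sum₁ + hm
    · rw [u₁, v₂u]; linear_combination s * h.bound_sum₂ + s' * h'.bound_sum₂ + hm
  · simp only [Prod.smul_mk, Prod.mk_add_mk, smul_eq_mul]
    constructor
    · rw [u₁v, u₂v]; linear_combination s * g.bound₁_cond + s' * g'.bound₁_cond + L₁ * hss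
    · rw [u₁, u₂]; linear_combination s * g.bound₁ + s' * g'.bound₁ + L₁ * hss
    · rw [v₂u, v₁u]; linear_combination s * g.bound₂_cond + s' * g'.bound₂_cond + L₂ * hss
    · rw [v₂, v₁]; linear_combination s * g.bound₂ + s' * g'.bound₂ + L₂ * hss

end SingleLetter

/-! ### Pasts and futures of sequences, chain rules, the Csiszár sum identity -/

section Sequences

variable {Y : Type*} {n : ℕ}

/-- The entries of `y` before position `i`. -/
def past (y : Fin n → Y) (i : ℕ) : Fin n → Option Y :=
  fun k => if (k : ℕ) < i then some (y k) else none

/-- The entries of `y` from position `i` on. -/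
def future (y : Fin n → Y) (i : ℕ) : Fin n → Option Y :=
  fun k => if i ≤ (k : ℕ) then some (y k) else none

theorem past_eq_iff {y y' : Fin n → Y} {i : ℕ} :
    past y' i = past y i ↔ ∀ k : Fin n, (k : ℕ) < i → y' k = y k := by
  rw [funext_iff]
  refine forall_congr' fun k => ?_
  unfold past
  split_ifs with h <;> simp [h]

theorem future_eq_iff {y y' : Fin n → Y} {i : ℕ} :
    future y' i = future y i ↔ ∀ k : Fin n, i ≤ (k : ℕ) → y' k = y k := by
  rw [funext_iff]
  refine forall_congr' fun k => ?_
  unfold future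
  split_ifs with h <;> simp [h]

theorem past_succ_eq_iff {y y' : Fin n → Y} (i : Fin n) :
    past y' (i + 1) = past y (i + 1) ↔ past y' i = past y i ∧ y' i = y i := by
  simp only [past_eq_iff]
  refine ⟨fun h => ⟨fun k hk => h k (by omega), h i (by omega)⟩, fun h k hk => ?_⟩
  rcases Nat.lt_succ_iff_lt_or_eq.1 hk with h1 | h1
  · exact h.1 k h1
  · rw [Fin.ext h1]; exact h.2

theorem future_eq_iff_succ {y y' : Fin n → Y} (i : Fin n) :
    future y' i = future y i ↔ future y' (i + 1) = future y (i + 1) ∧ y' i = y i := by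
  simp only [future_eq_iff]
  refine ⟨fun h => ⟨fun k hk => h k (by omega), h i le_rfl⟩, fun h k hk => ?_⟩
  rcases hk.eq_or_lt with h1 | h1
  · rw [← Fin.ext h1]; exact h.2
  · exact h.1 k h1

theorem past_zero (y : Fin n → Y) : past y 0 = fun _ => none := by
  funext k
  simp [past]

theorem future_length (y : Fin n → Y) : future y n = fun _ => none := by
  funext k
  simp [future]

theorem past_length_eq_iff {y y' : Fin n → Y} : past y' n = past y n ↔ y' = y := by
  rw [past_eq_iff, funext_iff]
  simp

theorem future_zero_eq_iff {y y' : Fin n → Y} : future y' 0 = future y 0 ↔ y' = y := by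
  rw [future_eq_iff, funext_iff]
  simp

theorem sum_fin_sub (g : ℕ → ℝ) : ∑ i : Fin n, (g (i + 1) - g i) = g n - g 0 := by
  rw [Fin.sum_univ_eq_sum_range (fun i => g (i + 1) - g i), Finset.sum_range_sub]

variable {Ω Y₁ Y₂ γ : Type*} [Fintype Ω] [Fintype Y₁] [Fintype Y₂] [Fintype γ] {P : Ω → ℝ}

theorem entropy_prod_le {α β : Type*} [Fintype α] [Fintype β] (hP : P ∈ stdSimplex ℝ Ω) (A : Ω → α)
    (B : Ω → β) : entropy P (fun ω => (A ω, B ω)) ≤ entropy P A + entropy P B := by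
  have := condEntropy_le_entropy hP A B
  unfold condEntropy at this
  linarith

theorem entropy_seq_le (hP : P ∈ stdSimplex ℝ Ω) (y : Ω → Fin n → Y₁) :
    entropy P y ≤ ∑ i, entropy P (fun ω => y ω i) := by
  classical
  have h : ∀ i : Fin n, entropy P (fun ω => past (y ω) (i + 1)) - entropy P (fun ω => past (y ω) i) ≤
      entropy P (fun ω => y ω i) := fun i => by
    refine le_trans (le_of_eq ?_)
      (condEntropy_le_entropy hP (fun ω => y ω i) (fun ω => past (y ω) i))
    rw [condEntropy]
    congr 1
    exact entropy_congr fun ω ω' => by simp [past_succ_eq_iff, and_comm]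
  have h2 := Finset.sum_le_sum fun i (_ : i ∈ Finset.univ) => h i
  rw [sum_fin_sub (fun i => entropy P (fun ω => past (y ω) i))] at h2
  refine le_trans (le_of_eq ?_) h2
  rw [entropy_congr (A := fun ω => past (y ω) 0) (B := fun _ : Ω => ())
    fun ω ω' => by simp [past_zero], entropy_unit hP, sub_zero]
  exact entropy_congr fun ω ω' => past_length_eq_iff.symm

/-- `∑ᵢ H(Y₁ᵢ | C, Y₁^{i-1}, Y₂_{i+1}^n) ≤ H(Y₁^n | C)`. -/
theorem sum_condEntropy_le (hP : P ∈ stdSimplex ℝ Ω) (y₁ : Ω → Fin n → Y₁) (y₂ : Ω → Fin n → Y₂)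
    (C : Ω → γ) :
    ∑ i : Fin n, condEntropy P (fun ω => y₁ ω i)
      (fun ω => (C ω, past (y₁ ω) i, future (y₂ ω) (i + 1))) ≤ condEntropy P y₁ C := by
  have h : ∀ i : Fin n, condEntropy P (fun ω => y₁ ω i)
      (fun ω => (C ω, past (y₁ ω) i, future (y₂ ω) (i + 1))) ≤
      entropy P (fun ω => (C ω, past (y₁ ω) (i + 1))) - entropy P (fun ω => (C ω, past (y₁ ω) i)) :=
    fun i => by
      -- Forgetting the future of Y₂ increases the conditional entropy; what remains telescopes by
      -- the chain rule.
      refine (condEntropy_anti hP (C := fun ω => (C ω, past (y₁ ω) i))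
        fun ω ω' h => by simp at h; simp [h]).trans_eq ?_
      rw [condEntropy]
      congr 1
      exact entropy_congr fun ω ω' => by simp [past_succ_eq_iff]; tauto
  refine (Finset.sum_le_sum fun i _ => h i).trans_eq ?_
  rw [sum_fin_sub (fun i => entropy P (fun ω => (C ω, past (y₁ ω) i))), condEntropy]
  congr 1
  · exact entropy_congr fun ω ω' => by simp [past_length_eq_iff, and_comm]
  · exact entropy_congr fun ω ω' => by simp [past_zero]

/-- The Csiszár sum identity:
`∑ᵢ (H(Y₁ᵢ | C, Y₁^{i-1}, Y₂_{i+1}^n) - H(Y₂ᵢ | C, Y₁^{i-1}, Y₂_{i+1}^n)) = H(Y₁^n | C) - H(Y₂^n | C)`. -/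
theorem csiszar_sum (y₁ : Ω → Fin n → Y₁) (y₂ : Ω → Fin n → Y₂) (C : Ω → γ) :
    ∑ i : Fin n, condEntropy P (fun ω => y₁ ω i)
        (fun ω => (C ω, past (y₁ ω) i, future (y₂ ω) (i + 1))) -
      ∑ i : Fin n, condEntropy P (fun ω => y₂ ω i)
        (fun ω => (C ω, past (y₁ ω) i, future (y₂ ω) (i + 1))) =
      condEntropy P y₁ C - condEntropy P y₂ C := by
  rw [← Finset.sum_sub_distrib]
  -- Adjoining Y₁ᵢ extends the past of Y₁ and adjoining Y₂ᵢ extends the future of Y₂, so the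
  -- difference is an increment of i ↦ H(C, Y₁^{i-1}, Y₂_i^n). This runs from H(C, Y₂^n) to H(C,
  -- Y₁^n).
  have h : ∀ i : Fin n, condEntropy P (fun ω => y₁ ω i)
        (fun ω => (C ω, past (y₁ ω) i, future (y₂ ω) (i + 1))) -
      condEntropy P (fun ω => y₂ ω i) (fun ω => (C ω, past (y₁ ω) i, future (y₂ ω) (i + 1))) =
      entropy P (fun ω => (C ω, past (y₁ ω) (i + 1), future (y₂ ω) (i + 1))) -
        entropy P (fun ω => (C ω, past (y₁ ω) i, future (y₂ ω) i)) := fun i => by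
    unfold condEntropy
    rw [entropy_congr (A := fun ω => (y₁ ω i, C ω, past (y₁ ω) i, future (y₂ ω) (i + 1)))
      (B := fun ω => (C ω, past (y₁ ω) (i + 1), future (y₂ ω) (i + 1)))
      fun ω ω' => by simp [past_succ_eq_iff]; tauto,
      entropy_congr (A := fun ω => (y₂ ω i, C ω, past (y₁ ω) i, future (y₂ ω) (i + 1)))
      (B := fun ω => (C ω, past (y₁ ω) i, future (y₂ ω) i))
      fun ω ω' => by simp [future_eq_iff_succ i]; tauto]
    ring
  rw [Finset.sum_congr rfl fun i _ => h i,
    sum_fin_sub (fun i => entropy P (fun ω => (C ω, past (y₁ ω) i, future (y₂ ω) i)))]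
  unfold condEntropy
  rw [entropy_congr (A := fun ω => (C ω, past (y₁ ω) n, future (y₂ ω) n))
    (B := fun ω => (y₁ ω, C ω))
    fun ω ω' => by simp [past_length_eq_iff, future_length, and_comm],
    entropy_congr (A := fun ω => (C ω, past (y₁ ω) 0, future (y₂ ω) 0))
    (B := fun ω => (y₂ ω, C ω))
    fun ω ω' => by simp [future_zero_eq_iff, past_zero, and_comm]]
  ring

end Sequences

/-! ### The n-letter converse -/

section Converse

variable {Ω Y₁ Y₂ μ₀ μ₁ μ₂ : Type*} [Fintype Ω] [Fintype Y₁] [Fintype Y₂] [Fintype μ₀]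
  [Fintype μ₁] [Fintype μ₂] {n : ℕ}

/-- The single-letter bounds of the converse, with slack `δ`. -/
structure ApproxBounds (m : ℝ) (e₁ e₂ : Bool → Bool → ℝ) (δ L₁ L₂ R₀ R₁ R₂ : ℝ) : Prop where
  bound₀ : R₀ ≤ m + δ
  bound₀₁ : R₀ + R₁ ≤ e₁ false false - e₁ true false + m + δ
  bound₀₂ : R₀ + R₂ ≤ e₂ false false - e₂ false true + m + δ
  bound_sum₁ : R₀ + R₁ + R₂ ≤ (e₁ false true - e₁ true true) + (e₂ false false - e₂ false true) + m + δ
  bound_sum₂ : R₀ + R₁ + R₂ ≤ (e₁ false false - e₁ true false) + (e₂ true false - e₂ true true) + m + δ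
  bound₁_cond : R₁ ≤ (e₁ false true - e₁ true true) - (e₂ false true - e₂ true true) + L₁ + δ
  bound₁ : R₁ ≤ (e₁ false false - e₁ true false) - (e₂ false false - e₂ true false) + L₁ + δ
  bound₂_cond : R₂ ≤ (e₂ true false - e₂ true true) - (e₁ true false - e₁ true true) + L₂ + δ
  bound₂ : R₂ ≤ (e₂ false false - e₂ false true) - (e₁ false false - e₁ false true) + L₂ + δ

/-- Used with s = 1/n. The error τ absorbs the rounding of the message sets and the leakage
tolerance; a sum-rate bound meets it three times, hence 3τ. -/
theorem ApproxBounds.rescale {m : ℝ} {e₁ e₂ : Bool → Bool → ℝ}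
    {δ L₁ L₂ R₀ R₁ R₂ δ' L₁' L₂' R₀' R₁' R₂' s τ : ℝ} (h : ApproxBounds m e₁ e₂ δ L₁ L₂ R₀ R₁ R₂)
    (hs : 0 ≤ s) (hτ : 0 ≤ τ) (h₀ : R₀' ≤ s * R₀ + τ) (h₁ : R₁' ≤ s * R₁ + τ)
    (h₂ : R₂' ≤ s * R₂ + τ) (hL₁ : s * L₁ ≤ L₁' + τ) (hL₂ : s * L₂ ≤ L₂' + τ)
    (hδ : 3 * τ + s * δ ≤ δ') :
    ApproxBounds (s * m) (fun i j => s * e₁ i j) (fun i j => s * e₂ i j) δ' L₁' L₂' R₀' R₁' R₂' := by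
  constructor
  · linear_combination s * h.bound₀ + h₀ + hδ + 2 * hτ
  · linear_combination s * h.bound₀₁ + h₀ + h₁ + hδ + hτ
  · linear_combination s * h.bound₀₂ + h₀ + h₂ + hδ + hτ
  · linear_combination s * h.bound_sum₁ + h₀ + h₁ + h₂ + hδ
  · linear_combination s * h.bound_sum₂ + h₀ + h₁ + h₂ + hδ
  · linear_combination s * h.bound₁_cond + h₁ + hL₁ + hδ + hτ
  · linear_combination s * h.bound₁ + h₁ + hL₁ + hδ + hτ
  · linear_combination s * h.bound₂_cond + h₂ + hL₂ + hδ + hτ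
  · linear_combination s * h.bound₂ + h₂ + hL₂ + hδ + hτ

/-- `∑ᵢ H(Y₁ᵢ | Wᵢ, [M₁], [M₂])` with `Wᵢ = (M₀, Y₁^{i-1}, Y₂_{i+1}^n)`. -/
noncomputable def nEntropy₁ (P : Ω → ℝ) (M₀ : Ω → μ₀) (M₁ : Ω → μ₁) (M₂ : Ω → μ₂)
    (y₁ : Ω → Fin n → Y₁) (y₂ : Ω → Fin n → Y₂) (a b : Bool) : ℝ :=
  ∑ i : Fin n, condEntropy P (fun ω => y₁ ω i) fun ω =>
    ((M₀ ω, past (y₁ ω) i, future (y₂ ω) (i + 1)), keep a (M₁ ω), keep b (M₂ ω))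

/-- `∑ᵢ H(Y₂ᵢ | Wᵢ, [M₁], [M₂])` with `Wᵢ = (M₀, Y₁^{i-1}, Y₂_{i+1}^n)`. -/
noncomputable def nEntropy₂ (P : Ω → ℝ) (M₀ : Ω → μ₀) (M₁ : Ω → μ₁) (M₂ : Ω → μ₂)
    (y₁ : Ω → Fin n → Y₁) (y₂ : Ω → Fin n → Y₂) (a b : Bool) : ℝ :=
  ∑ i : Fin n, condEntropy P (fun ω => y₂ ω i) fun ω =>
    ((M₀ ω, past (y₁ ω) i, future (y₂ ω) (i + 1)), keep a (M₁ ω), keep b (M₂ ω))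

/-- The converse for `n` letters, before normalization. -/
theorem approxBounds_of_fano {P : Ω → ℝ} (hP : P ∈ stdSimplex ℝ Ω) (M₀ : Ω → μ₀) (M₁ : Ω → μ₁)
    (M₂ : Ω → μ₂) (y₁ : Ω → Fin n → Y₁) (y₂ : Ω → Fin n → Y₂) {r₀ r₁ r₂ δ L₁ L₂ : ℝ} (hδ : 0 ≤ δ)
    (h₀ : entropy P M₀ ≤ r₀) (h₁ : entropy P M₁ ≤ r₁) (h₂ : entropy P M₂ ≤ r₂)
    (h₀₁₂ : r₀ + r₁ + r₂ ≤ entropy P (fun ω => (M₀ ω, M₁ ω, M₂ ω)))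
    (hf₁ : condEntropy P (fun ω => (M₀ ω, M₁ ω)) y₁ ≤ δ)
    (hf₂ : condEntropy P (fun ω => (M₀ ω, M₂ ω)) y₂ ≤ δ)
    (hL₁ : mutualInfo P M₁ y₂ ≤ L₁) (hL₂ : mutualInfo P M₂ y₁ ≤ L₂) :
    ApproxBounds
      (min
        (∑ i, entropy P (fun ω => y₁ ω i) - nEntropy₁ P M₀ M₁ M₂ y₁ y₂ false false)
        (∑ i, entropy P (fun ω => y₂ ω i) - nEntropy₂ P M₀ M₁ M₂ y₁ y₂ false false))
      (nEntropy₁ P M₀ M₁ M₂ y₁ y₂) (nEntropy₂ P M₀ M₁ M₂ y₁ y₂)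
      (3 * δ) L₁ L₂ r₀ r₁ r₂ := by
  set k₁ := ∑ i, entropy P fun ω => y₁ ω i
  set k₂ := ∑ i, entropy P fun ω => y₂ ω i
  set e₁ : Bool → Bool → ℝ := nEntropy₁ P M₀ M₁ M₂ y₁ y₂
  set e₂ : Bool → Bool → ℝ := nEntropy₂ P M₀ M₁ M₂ y₁ y₂
  let C : Bool → Bool → Ω → μ₀ × Option μ₁ × Option μ₂ :=
    fun a b ω => (M₀ ω, keep a (M₁ ω), keep b (M₂ ω))
  have hk₁ : entropy P y₁ ≤ k₁ := entropy_seq_le hP y₁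
  have hk₂ : entropy P y₂ ≤ k₂ := entropy_seq_le hP y₂
  have e₁C : ∀ a b, e₁ a b = ∑ i : Fin n, condEntropy P (fun ω => y₁ ω i)
      (fun ω => (C a b ω, past (y₁ ω) i, future (y₂ ω) (i + 1))) := fun a b =>
    Finset.sum_congr rfl fun i _ => condEntropy_congr (fun _ _ => Iff.rfl)
      fun ω ω' => by simp [C]; tauto
  have e₂C : ∀ a b, e₂ a b = ∑ i : Fin n, condEntropy P (fun ω => y₂ ω i)
      (fun ω => (C a b ω, past (y₁ ω) i, future (y₂ ω) (i + 1))) := fun a b =>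
    Finset.sum_congr rfl fun i _ => condEntropy_congr (fun _ _ => Iff.rfl)
      fun ω ω' => by simp [C]; tauto
  obtain ⟨c, hc⟩ : ∃ c : Bool → Bool → ℝ, ∀ a b, c a b = entropy P (C a b) := ⟨_, fun _ _ => rfl⟩
  obtain ⟨d₁, hd₁⟩ : ∃ d : Bool → Bool → ℝ, ∀ a b, d a b = entropy P (fun ω => (y₁ ω, C a b ω)) :=
    ⟨_, fun _ _ => rfl⟩
  obtain ⟨d₂, hd₂⟩ : ∃ d : Bool → Bool → ℝ, ∀ a b, d a b = entropy P (fun ω => (y₂ ω, C a b ω)) :=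
    ⟨_, fun _ _ => rfl⟩
  -- Here c = H(C) and d_j = H(Y_j^n, C), so H(C) cancels in the Csiszár identity. The next
  -- inequality is needed for Y₁ only; its analogue for Y₂ follows from this identity.
  have hcs : ∀ a b, e₁ a b - e₂ a b = d₁ a b - d₂ a b := fun a b => by
    rw [e₁C, e₂C, csiszar_sum, hd₁, hd₂]
    unfold condEntropy
    ring
  have hle : ∀ a b, e₁ a b ≤ d₁ a b - c a b := fun a b => by
    rw [e₁C, hd₁, hc]
    exact sum_condEntropy_le hP y₁ y₂ (C a b)
  have hcff : c false false ≤ r₀ := by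
    rw [hc]
    exact (entropy_congr fun ω ω' => by simp [C]).trans_le h₀
  have hctt : r₀ + r₁ + r₂ ≤ c true true := by
    rw [hc]
    exact h₀₁₂.trans_eq (entropy_congr fun ω ω' => by simp [C])
  have hctf : c true false ≤ c false false + entropy P M₁ := by
    rw [hc, hc]
    exact (entropy_congr fun ω ω' => by simp [C]).trans_le (entropy_prod_le hP (C false false) M₁)
  have hcft : c false true ≤ c false false + entropy P M₂ := by
    rw [hc, hc]
    exact (entropy_congr fun ω ω' => by simp [C]).trans_le (entropy_prod_le hP (C false false) M₂)
  have hctt₁ : c true true ≤ c false true + entropy P M₁ := by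
    rw [hc, hc]
    exact (entropy_congr fun ω ω' => by simp [C]; tauto).trans_le (entropy_prod_le hP (C false true) M₁)
  have hctt₂ : c true true ≤ c true false + entropy P M₂ := by
    rw [hc, hc]
    exact (entropy_congr fun ω ω' => by simp [C]; tauto).trans_le (entropy_prod_le hP (C true false) M₂)
  -- Fano: adjoining the messages that a receiver decodes to its output adds at most δ.
  have f₁ : d₁ true false ≤ entropy P y₁ + δ := by
    rw [hd₁, entropy_congr (B := fun ω => ((M₀ ω, M₁ ω), y₁ ω)) fun ω ω' => by simp [C]; tauto]
    unfold condEntropy at hf₁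
    linarith
  have f₂ : d₂ false true ≤ entropy P y₂ + δ := by
    rw [hd₂, entropy_congr (B := fun ω => ((M₀ ω, M₂ ω), y₂ ω)) fun ω ω' => by simp [C]; tauto]
    unfold condEntropy at hf₂
    linarith
  have m₁ : d₁ false false ≤ d₁ true false := by
    rw [hd₁, hd₁]; exact entropy_mono hP fun ω ω' => by simp [C]; tauto
  have m₂ : d₂ false false ≤ d₂ false true := by
    rw [hd₂, hd₂]; exact entropy_mono hP fun ω ω' => by simp [C]; tauto
  have m₃ : entropy P y₁ ≤ d₁ false false := by
    rw [hd₁]; exact entropy_mono hP fun ω ω' => by simp [C]; tauto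
  have m₄ : entropy P y₂ ≤ d₂ false false := by
    rw [hd₂]; exact entropy_mono hP fun ω ω' => by simp [C]; tauto
  -- Strong subadditivity: adjoining M₁ costs no more once M₂ is present. Hence it still costs
  -- receiver 1 at most δ given (M₀, M₂, Y₁^n); `s₂` is the analogue for M₂ at receiver 2.
  have s₁ : d₁ true true + d₁ false false ≤ d₁ true false + d₁ false true := by
    simp only [hd₁]
    have := entropy_submodular hP M₁ M₂ (fun ω => (y₁ ω, C false false ω))
    refine (le_of_eq ?_).trans (this.trans (le_of_eq ?_)) <;> congr 1 <;>
      exact entropy_congr fun ω ω' => by simp [C]; try tauto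
  have s₂ : d₂ true true + d₂ false false ≤ d₂ true false + d₂ false true := by
    simp only [hd₂]
    have := entropy_submodular hP M₁ M₂ (fun ω => (y₂ ω, C false false ω))
    refine (le_of_eq ?_).trans (this.trans (le_of_eq ?_)) <;> congr 1 <;>
      exact entropy_congr fun ω ω' => by simp [C]; try tauto
  -- The leakage hypothesis bounds H(M₁, Y₂^n) from below by H(M₁) + H(Y₂^n) - L₁, and this passes
  -- to the larger collections.
  have l₁ : entropy P (fun ω => (M₁ ω, y₂ ω)) ≤ d₂ true false := by
    rw [hd₂]; exact entropy_mono hP fun ω ω' => by simp [C]; tauto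
  have l₁' : entropy P (fun ω => (M₁ ω, y₂ ω)) ≤ d₂ true true := by
    rw [hd₂]; exact entropy_mono hP fun ω ω' => by simp [C]; tauto
  have l₂ : entropy P (fun ω => (M₂ ω, y₁ ω)) ≤ d₁ false true := by
    rw [hd₁]; exact entropy_mono hP fun ω ω' => by simp [C]; tauto
  have l₂' : entropy P (fun ω => (M₂ ω, y₁ ω)) ≤ d₁ true true := by
    rw [hd₁]; exact entropy_mono hP fun ω ω' => by simp [C]; tauto
  unfold mutualInfo condEntropy at hL₁ hL₂
  have cff := hcs false false
  have cft := hcs false true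
  have ctf := hcs true false
  have ctt := hcs true true
  have eff := hle false false
  have eft := hle false true
  have etf := hle true false
  have ett := hle true true
  clear_value e₁ e₂ k₁ k₂
  -- Each bound is now a linear combination. The sum-rate bounds need up to three Fano terms, for
  -- instance `bound_sum₁` when the minimum is k₁ - e₁(false, false); this is the origin of 3δ.
  constructor
  iterate 5
    rcases min_cases (k₁ - e₁ false false) (k₂ - e₂ false false) with ⟨h, -⟩ | ⟨h, -⟩ <;>
      rw [h] <;> linarith
  all_goals linarith

end Converse

/-! ### Absorbing the slack -/

section Slack

variable {X Y₁ Y₂ : Type*} [Fintype X] [Fintype Y₁] [Fintype Y₂] {Q : X → Y₁ × Y₂ → ℝ}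

/-- Rate triples that satisfy the bounds up to the slack `η` are moved into `outerSet` by lowering the
positive rates by `η`; the auxiliary variable of a vanishing private rate is dropped. -/
theorem mem_outerSet_of_approxBounds (hQ : ∀ x, Q x ∈ stdSimplex ℝ (Y₁ × Y₂)) {k₁ k₂ m : ℝ}
    {e₁ e₂ : Bool → Bool → ℝ}
    (H : ∀ su sv : Bool, ∃ (a b c : ℕ) (P : Fin a × Fin b × Fin c → ℝ) (K : Fin b × Fin c → X → ℝ),
      P ∈ stdSimplex ℝ (Fin a × Fin b × Fin c) ∧ (∀ s, K s ∈ stdSimplex ℝ X) ∧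
      HasProfile (jointLaw (inputLaw P K) Q) k₁ k₂ (fun i j => e₁ (i && su) (j && sv))
        (fun i j => e₂ (i && su) (j && sv)))
    {η L₁ L₂ R₀ R₁ R₂ R₀' R₁' R₂' : ℝ} (hη : 0 ≤ η) (hL₁ : 0 ≤ L₁) (hL₂ : 0 ≤ L₂)
    (hA : ApproxBounds m e₁ e₂ η L₁ L₂ R₀ R₁ R₂) (hm₁ : m ≤ k₁ - e₁ false false)
    (hm₂ : m ≤ k₂ - e₂ false false)
    (h₀ : (R₀ = 0 ∧ R₀' = 0) ∨ (R₀' = R₀ - η ∧ 0 ≤ R₀'))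
    (h₁ : (R₁ = 0 ∧ R₁' = 0) ∨ (R₁' = R₁ - η ∧ 0 ≤ R₁'))
    (h₂ : (R₂ = 0 ∧ R₂' = 0) ∨ (R₂' = R₂ - η ∧ 0 ≤ R₂')) :
    (R₀', R₁', R₂') ∈ outerSet Q L₁ L₂ := by
  -- With U dropped, the informations of U vanish, those of V given (W, U) become those given W, and
  -- each sum-rate bound reduces to the bound on R₀ + R₂. In the other bounds one lowered rate pays
  -- for η, and if all rates involved vanish, nonnegativity suffices.
  have key : ∀ su sv : Bool, ((su = false ∧ R₁ = 0 ∧ R₁' = 0) ∨ (su = true ∧ R₁' = R₁ - η ∧ 0 ≤ R₁')) →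
      ((sv = false ∧ R₂ = 0 ∧ R₂' = 0) ∨ (sv = true ∧ R₂' = R₂ - η ∧ 0 ≤ R₂')) →
      (R₀', R₁', R₂') ∈ outerSet Q L₁ L₂ := by
    intro su sv h₁ h₂
    obtain ⟨a, b, c, P, K, hP, hK, h⟩ := H su sv
    have hp := jointLaw_mem hQ (inputLaw_mem hP hK)
    set p := jointLaw (inputLaw P K) Q
    have hm := h.minInfoW_ge hm₁ hm₂
    have m₀ : 0 ≤ minInfoW p := le_min (mutualInfo_nonneg hp _ _) (mutualInfo_nonneg hp _ _)
    have n₁ : 0 ≤ infoU1 p := condMutualInfo_nonneg hp _ _ _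
    have n₂ : 0 ≤ infoU1V p := condMutualInfo_nonneg hp _ _ _
    have n₃ : 0 ≤ infoV2 p := condMutualInfo_nonneg hp _ _ _
    have n₄ : 0 ≤ infoV2U p := condMutualInfo_nonneg hp _ _ _
    obtain ⟨-, -, u₁, u₂, v₁, v₂, u₁v, u₂v, v₁u, v₂u⟩ := h
    obtain ⟨b1, b2, b3, b4, b5, b6, b7, b8, b9⟩ := hA
    refine ⟨a, b, c, P, K, hP, hK, ?_, ?_⟩
    all_goals
      rcases h₁ with ⟨rfl, h1, h1'⟩ | ⟨rfl, h1, h1'⟩ <;>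
      rcases h₂ with ⟨rfl, h2, h2'⟩ | ⟨rfl, h2, h2'⟩ <;>
      rcases h₀ with ⟨h0, h0'⟩ | ⟨h0, h0'⟩ <;>
      simp only [Bool.and_true, Bool.and_false] at u₁ u₂ v₁ v₂ u₁v u₂v v₁u v₂u hm <;>
      constructor <;> dsimp only <;> linarith
  rcases h₁ with h₁ | h₁ <;> rcases h₂ with h₂ | h₂
  · exact key false false (Or.inl ⟨rfl, h₁⟩) (Or.inl ⟨rfl, h₂⟩)
  · exact key false true (Or.inl ⟨rfl, h₁⟩) (Or.inr ⟨rfl, h₂⟩)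
  · exact key true false (Or.inr ⟨rfl, h₁⟩) (Or.inl ⟨rfl, h₂⟩)
  · exact key true true (Or.inr ⟨rfl, h₁⟩) (Or.inr ⟨rfl, h₂⟩)

end Slack

/-! ### Sizes of the message sets -/

section Messages

theorem one_le_two_pow {n : ℕ} {R : ℝ} (hR : 0 ≤ R) : (1 : ℝ) ≤ 2 ^ ((n : ℝ) * R) :=
  Real.one_le_rpow (by norm_num) (by positivity)

theorem card_msg_pos {n : ℕ} {R : ℝ} (hR : 0 ≤ R) : 0 < Fintype.card (Msg n R) := by
  rw [Fintype.card_fin]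
  exact Nat.floor_pos.2 (one_le_two_pow hR)

theorem log_card_msg_le {n : ℕ} {R : ℝ} (hR : 0 ≤ R) :
    Real.log (Fintype.card (Msg n R)) / Real.log 2 ≤ n * R := by
  have h := card_msg_pos (n := n) hR
  rw [div_le_iff₀ log_two_pos, ← Real.log_rpow (by norm_num)]
  refine Real.log_le_log (by exact_mod_cast h) ?_
  rw [Fintype.card_fin]
  exact Nat.floor_le (by positivity)

/-- Since the floor is at least 1, rounding down loses less than a factor 2, that is, at most one
bit. -/
theorem le_log_card_msg {n : ℕ} {R : ℝ} (hR : 0 ≤ R) :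
    n * R - 1 ≤ Real.log (Fintype.card (Msg n R)) / Real.log 2 := by
  have h := card_msg_pos (n := n) hR
  have h1 : (1 : ℝ) ≤ Fintype.card (Msg n R) := by exact_mod_cast h
  have h2 : (2 : ℝ) ^ ((n : ℝ) * R) < Fintype.card (Msg n R) + 1 := by
    rw [Fintype.card_fin]; exact Nat.lt_floor_add_one _
  have h3 : Real.log ((2 : ℝ) ^ ((n : ℝ) * R)) ≤ Real.log (2 * Fintype.card (Msg n R)) :=
    Real.log_le_log (by positivity) (by linarith)
  rw [Real.log_rpow (by norm_num), Real.log_mul (by norm_num) (by positivity)] at h3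
  rw [le_div_iff₀ log_two_pos]
  linarith

end Messages

/-! ### The law induced by a code -/

section CodeLaw

theorem sum_prod_channel {X Y₁ Y₂ : Type*} [Fintype Y₁] [Fintype Y₂] {Q : X → Y₁ × Y₂ → ℝ} {n : ℕ}
    (hQ : ∀ x, Q x ∈ stdSimplex ℝ (Y₁ × Y₂)) (x : Fin n → X) :
    ∑ y : (Fin n → Y₁) × (Fin n → Y₂), ∏ i, Q (x i) (y.1 i, y.2 i) = 1 := by
  classical
  rw [← (Equiv.arrowProdEquivProdArrow (Fin n) (fun _ => Y₁) (fun _ => Y₂)).sum_comp]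
  have h := Finset.prod_univ_sum (fun _ : Fin n => (Finset.univ : Finset (Y₁ × Y₂)))
    (fun i s => Q (x i) s)
  simp only [(hQ _).2, Finset.prod_const_one, Fintype.piFinset_univ] at h
  exact h.symm

variable {X Y₁ Y₂ : Type*} [Fintype X] [Fintype Y₁] [Fintype Y₂] {Q : X → Y₁ × Y₂ → ℝ} {n : ℕ}
  {R₀ R₁ R₂ : ℝ}

theorem sum_law (hQ : ∀ x, Q x ∈ stdSimplex ℝ (Y₁ × Y₂)) (c : Code X Y₁ Y₂ n R₀ R₁ R₂)
    (m : Msgs n R₀ R₁ R₂) :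
    ∑ s, c.law Q (m, s) = 1 / (Fintype.card (Msgs n R₀ R₁ R₂) : ℝ) := by
  rw [Fintype.sum_prod_type]
  calc ∑ x, ∑ y, c.law Q (m, x, y)
      = ∑ x, 1 / (Fintype.card (Msgs n R₀ R₁ R₂) : ℝ) * c.enc m x :=
        Finset.sum_congr rfl fun x _ => by
          simp only [Code.law]
          rw [← Finset.mul_sum, sum_prod_channel hQ, mul_one]
    _ = _ := by rw [← Finset.mul_sum, (c.enc_mem m).2, mul_one]

theorem prob_law_msgs (hQ : ∀ x, Q x ∈ stdSimplex ℝ (Y₁ × Y₂)) (c : Code X Y₁ Y₂ n R₀ R₁ R₂)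
    (m : Msgs n R₀ R₁ R₂) :
    prob (c.law Q) (fun ω => ω.1 = m) = 1 / (Fintype.card (Msgs n R₀ R₁ R₂) : ℝ) := by
  classical
  rw [← sum_law hQ c m, prob_eq_sum, Fintype.sum_prod_type, Finset.sum_eq_single m]
  · simp
  · intro m' _ h
    simp [h]
  · simp

theorem card_msgs_pos (h₀ : 0 ≤ R₀) (h₁ : 0 ≤ R₁) (h₂ : 0 ≤ R₂) :
    0 < Fintype.card (Msgs n R₀ R₁ R₂) := by
  rw [Fintype.card_prod, Fintype.card_prod]
  exact Nat.mul_pos (card_msg_pos h₀) (Nat.mul_pos (card_msg_pos h₁) (card_msg_pos h₂))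

theorem law_mem (hQ : ∀ x, Q x ∈ stdSimplex ℝ (Y₁ × Y₂)) (c : Code X Y₁ Y₂ n R₀ R₁ R₂)
    (h₀ : 0 ≤ R₀) (h₁ : 0 ≤ R₁) (h₂ : 0 ≤ R₂) :
    c.law Q ∈ stdSimplex ℝ (CodeSpace X Y₁ Y₂ n R₀ R₁ R₂) := by
  refine ⟨fun ω => mul_nonneg (mul_nonneg (by positivity) ((c.enc_mem _).1 _))
    (Finset.prod_nonneg fun i _ => (hQ _).1 _), ?_⟩
  have h : (Fintype.card (Msgs n R₀ R₁ R₂) : ℝ) ≠ 0 := by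
    exact_mod_cast (card_msgs_pos h₀ h₁ h₂).ne'
  rw [Fintype.sum_prod_type]
  simp only [sum_law hQ, Finset.sum_const, Finset.card_univ, nsmul_eq_mul]
  exact mul_one_div_cancel h

theorem past_update {Y : Type*} (y : Fin n → Y) (t : Fin n) (a : Y) :
    past (Function.update y t a) t = past y t := by
  rw [past_eq_iff]
  intro k hk
  rw [Function.update_of_ne]
  rintro rfl
  exact lt_irrefl _ hk

theorem future_update {Y : Type*} (y : Fin n → Y) (t : Fin n) (a : Y) :
    future (Function.update y t a) (t + 1) = future y (t + 1) := by
  rw [future_eq_iff]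
  intro k hk
  rw [Function.update_of_ne]
  rintro rfl
  omega

theorem update_eq_and_iff {Y : Type*} {y z : Fin n → Y} {t : Fin n} {a b : Y} (hz : z t = a) :
    (Function.update y t a = z ∧ y t = b) ↔ y = Function.update z t b := by
  constructor
  · rintro ⟨rfl, rfl⟩
    simp
  · rintro rfl
    simp [← hz]

/-- The law of a code, at time `t`: given everything but the outputs at time `t`, these outputs are
generated by the channel from the input at time `t`. -/
theorem prob_law_and (c : Code X Y₁ Y₂ n R₀ R₁ R₂) (a₁ : Y₁) (a₂ : Y₂) (t : Fin n) :
    ∃ r : CodeSpace X Y₁ Y₂ n R₀ R₁ R₂ → ℝ, ∀ z b₁ b₂,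
      prob (c.law Q) (fun ω => (ω.1, ω.2.1, Function.update ω.2.2.1 t a₁,
        Function.update ω.2.2.2 t a₂) = z ∧ ω.2.2.1 t = b₁ ∧ ω.2.2.2 t = b₂) =
      r z * Q (z.2.1 t) (b₁, b₂) := by
  classical
  -- The state has its outputs at time t overwritten by a₁, a₂, so other states have probability
  -- zero. On the rest, `r` is the code law without the channel factor at time t.
  refine ⟨fun z => if z.2.2.1 t = a₁ ∧ z.2.2.2 t = a₂ then
    1 / (Fintype.card (Msgs n R₀ R₁ R₂) : ℝ) * c.enc z.1 z.2.1 *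
      ∏ i ∈ Finset.univ.erase t, Q (z.2.1 i) (z.2.2.1 i, z.2.2.2 i) else 0, ?_⟩
  rintro ⟨m, x, z₁, z₂⟩ b₁ b₂
  dsimp only
  split_ifs with h
  · rw [prob_eq_single (m, x, Function.update z₁ t b₁, Function.update z₂ t b₂)]
    · simp only [Code.law]
      rw [← Finset.mul_prod_erase _ _ (Finset.mem_univ t)]
      simp only [Function.update_self]
      rw [Finset.prod_congr rfl fun i hi => by
        rw [Function.update_of_ne (Finset.ne_of_mem_erase hi),
          Function.update_of_ne (Finset.ne_of_mem_erase hi)]]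
      ring
    · rintro ⟨m', x', y₁, y₂⟩
      simp only [Prod.mk.injEq]
      rw [← update_eq_and_iff h.1, ← update_eq_and_iff h.2]
      tauto
  · rw [zero_mul, prob_eq_zero]
    rintro ⟨m', x', y₁, y₂⟩ ⟨h1, -⟩
    simp only [Prod.mk.injEq] at h1
    obtain ⟨-, -, rfl, rfl⟩ := h1
    simp at h

/-- Uniform independent messages make the joint message entropy equal to the sum of the
log-cardinalities. The error event contains that of each receiver, so Fano applies to both with the
same ε. -/
theorem approxBounds_of_code (hQ : ∀ x, Q x ∈ stdSimplex ℝ (Y₁ × Y₂))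
    (c : Code X Y₁ Y₂ n R₀ R₁ R₂) (h₀ : 0 ≤ R₀) (h₁ : 0 ≤ R₁) (h₂ : 0 ≤ R₂) {ε L₁ L₂ : ℝ}
    (hε : 0 ≤ ε) (he : c.errorProb Q ≤ ε)
    (hL₁ : mutualInfo (c.law Q) (fun ω => ω.1.2.1) (fun ω => ω.2.2.2) ≤ L₁)
    (hL₂ : mutualInfo (c.law Q) (fun ω => ω.1.2.2) (fun ω => ω.2.2.1) ≤ L₂) :
    ApproxBounds
      (min
        (∑ i, entropy (c.law Q) (fun ω => ω.2.2.1 i) - nEntropy₁ (c.law Q) (fun ω => ω.1.1)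
          (fun ω => ω.1.2.1) (fun ω => ω.1.2.2) (fun ω => ω.2.2.1) (fun ω => ω.2.2.2) false false)
        (∑ i, entropy (c.law Q) (fun ω => ω.2.2.2 i) - nEntropy₂ (c.law Q) (fun ω => ω.1.1)
          (fun ω => ω.1.2.1) (fun ω => ω.1.2.2) (fun ω => ω.2.2.1) (fun ω => ω.2.2.2) false false))
      (nEntropy₁ (c.law Q) (fun ω => ω.1.1) (fun ω => ω.1.2.1) (fun ω => ω.1.2.2)
        (fun ω => ω.2.2.1) (fun ω => ω.2.2.2))
      (nEntropy₂ (c.law Q) (fun ω => ω.1.1) (fun ω => ω.1.2.1) (fun ω => ω.1.2.2)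
        (fun ω => ω.2.2.1) (fun ω => ω.2.2.2))
      (3 * (1 + ε * (n * (R₀ + R₁ + R₂)))) L₁ L₂
      (Real.log (Fintype.card (Msg n R₀)) / Real.log 2)
      (Real.log (Fintype.card (Msg n R₁)) / Real.log 2)
      (Real.log (Fintype.card (Msg n R₂)) / Real.log 2) := by
  have hP := law_mem hQ c h₀ h₁ h₂
  have c₀ : (Fintype.card (Msg n R₀) : ℝ) ≠ 0 := by exact_mod_cast (card_msg_pos h₀).ne'
  have c₁ : (Fintype.card (Msg n R₁) : ℝ) ≠ 0 := by exact_mod_cast (card_msg_pos h₁).ne'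
  have c₂ : (Fintype.card (Msg n R₂) : ℝ) ≠ 0 := by exact_mod_cast (card_msg_pos h₂).ne'
  have l₀ := log_card_msg_le (n := n) h₀
  have l₁ := log_card_msg_le (n := n) h₁
  have l₂ := log_card_msg_le (n := n) h₂
  have n₀ : 0 ≤ n * R₀ := by positivity
  have n₁ : 0 ≤ n * R₁ := by positivity
  have n₂ : 0 ≤ n * R₂ := by positivity
  refine approxBounds_of_fano hP _ _ _ _ _ (by positivity) (entropy_le_log_card hP _)
    (entropy_le_log_card hP _) (entropy_le_log_card hP _) ?_ ?_ ?_ hL₁ hL₂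
  · rw [entropy_congr (B := fun ω => ω.1) fun ω ω' => by simp [Prod.ext_iff],
      entropy_eq_log_card (prob_law_msgs hQ c), Fintype.card_prod, Fintype.card_prod,
      Nat.cast_mul, Nat.cast_mul, Real.log_mul c₀ (mul_ne_zero c₁ c₂), Real.log_mul c₁ c₂]
    exact le_of_eq (by ring)
  · refine (fano hP _ _ c.dec₁ (le_trans (prob_mono hP.1 ?_) he)).trans ?_
    · rintro ⟨m, x, y₁, y₂⟩ h
      exact Or.inl h
    · rw [Fintype.card_prod, Nat.cast_mul, Real.log_mul c₀ c₁, add_div]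
      gcongr
      linarith
  · refine (fano hP _ _ c.dec₂ (le_trans (prob_mono hP.1 ?_) he)).trans ?_
    · rintro ⟨m, x, y₁, y₂⟩ h
      exact Or.inr h
    · rw [Fintype.card_prod, Nat.cast_mul, Real.log_mul c₀ c₂, add_div]
      gcongr
      linarith

/-- Time sharing with T uniform on the n positions. The hidden state at time t is everything but the
two outputs at time t; absence of memory and feedback makes these depend on the state through the
current input alone. -/
theorem exists_hasProfile_of_code (hQ : ∀ x, Q x ∈ stdSimplex ℝ (Y₁ × Y₂))
    (c : Code X Y₁ Y₂ n R₀ R₁ R₂) (hn : 0 < n) (h₀ : 0 ≤ R₀) (h₁ : 0 ≤ R₁) (h₂ : 0 ≤ R₂)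
    (su sv : Bool) :
    ∃ (a b d : ℕ) (P : Fin a × Fin b × Fin d → ℝ) (K : Fin b × Fin d → X → ℝ),
      P ∈ stdSimplex ℝ (Fin a × Fin b × Fin d) ∧ (∀ s, K s ∈ stdSimplex ℝ X) ∧
      HasProfile (jointLaw (inputLaw P K) Q)
        ((1 / (n : ℝ)) * ∑ i, entropy (c.law Q) (fun ω => ω.2.2.1 i))
        ((1 / (n : ℝ)) * ∑ i, entropy (c.law Q) (fun ω => ω.2.2.2 i))
        (fun i j => (1 / (n : ℝ)) * nEntropy₁ (c.law Q) (fun ω => ω.1.1) (fun ω => ω.1.2.1)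
          (fun ω => ω.1.2.2) (fun ω => ω.2.2.1) (fun ω => ω.2.2.2) (i && su) (j && sv))
        (fun i j => (1 / (n : ℝ)) * nEntropy₂ (c.law Q) (fun ω => ω.1.1) (fun ω => ω.1.2.1)
          (fun ω => ω.1.2.2) (fun ω => ω.2.2.1) (fun ω => ω.2.2.2) (i && su) (j && sv)) := by
  have hP := law_mem hQ c h₀ h₁ h₂
  obtain ⟨ω₀⟩ : Nonempty (CodeSpace X Y₁ Y₂ n R₀ R₁ R₂) := by
    by_contra h
    rw [not_nonempty_iff] at h
    simpa using hP.2
  have hn' : (n : ℝ) ≠ 0 := by exact_mod_cast hn.ne'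
  -- Any fixed letters may overwrite position t. The past before t and the future after t do not see
  -- it, so W_t is a function of the overwritten state.
  choose r hr using fun t => prob_law_and (Q := Q) c (ω₀.2.2.1 ⟨0, hn⟩) (ω₀.2.2.2 ⟨0, hn⟩) t
  obtain ⟨a, b, d, P, K, hP', hK, h⟩ := exists_inputLaw_timeSharing (Q := Q) hQ
    (l := fun _ : Fin n => 1 / (n : ℝ)) ⟨fun _ => by positivity, by simp [hn']⟩ hP
    (fun t ω => (ω.1, ω.2.1, Function.update ω.2.2.1 t (ω₀.2.2.1 ⟨0, hn⟩),
        Function.update ω.2.2.2 t (ω₀.2.2.2 ⟨0, hn⟩)))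
    (fun t z => (z.1.1, past z.2.2.1 t, future z.2.2.2 (t + 1)))
    (fun _ z => z.1.2.1) (fun _ z => z.1.2.2) (fun t z => z.2.1 t) (fun t ω => ω.2.2.1 t)
    (fun t ω => ω.2.2.2 t) r hr su sv
  refine ⟨a, b, d, P, K, hP', hK, ?_⟩
  simp only [past_update, future_update, ← Finset.mul_sum] at h
  exact h

end CodeLaw

/-! ### From codes to the outer region -/

section Main

variable {X Y₁ Y₂ : Type*} [Fintype X] [Fintype Y₁] [Fintype Y₂] {Q : X → Y₁ × Y₂ → ℝ}
  {L₁ L₂ R₀ R₁ R₂ : ℝ}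

theorem exists_mem_outerSet_of_achievable (hQ : ∀ x, Q x ∈ stdSimplex ℝ (Y₁ × Y₂)) (hL₁ : 0 ≤ L₁)
    (hL₂ : 0 ≤ L₂) (h : Achievable Q L₁ L₂ R₀ R₁ R₂) {η R₀' R₁' R₂' : ℝ} (hη : 0 < η)
    (h₀ : (R₀ = 0 ∧ R₀' = 0) ∨ (R₀' = R₀ - η ∧ 0 ≤ R₀'))
    (h₁ : (R₁ = 0 ∧ R₁' = 0) ∨ (R₁' = R₁ - η ∧ 0 ≤ R₁'))
    (h₂ : (R₂ = 0 ∧ R₂' = 0) ∨ (R₂' = R₂ - η ∧ 0 ≤ R₂')) :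
    (R₀', R₁', R₂') ∈ outerSet Q L₁ L₂ := by
  obtain ⟨p₀, p₁, p₂, h⟩ := h
  set S := R₀ + R₁ + R₂ with hS
  have hS0 : 0 ≤ S := by positivity
  -- The slack is budgeted as 3η/8 for rates and leakages, 3/n ≤ η/8 for the constant in Fano's
  -- inequality, and η/4 for its error term, since 3εS ≤ η/4. The total 3η/4 is below η.
  obtain ⟨n, hn, c, he, hl₁, hl₂⟩ := h (η / (12 * (S + 1))) (by positivity) (η / 8) (by positivity)
    (η / 8) (by positivity) ⌈24 / η⌉₊
  have hn0 : 0 < n := (Nat.zero_le _).trans_lt hn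
  have hnr : (0 : ℝ) < n := by exact_mod_cast hn0
  have hn1 : 1 / (n : ℝ) ≤ η / 24 := by
    have h1 : 24 / η ≤ n := (Nat.le_ceil _).trans (by exact_mod_cast hn.le)
    rw [div_le_iff₀ hη] at h1
    rw [div_le_iff₀ hnr]
    linarith
  have hl₁' : mutualInfo (c.law Q) (fun ω => ω.1.2.1) (fun ω => ω.2.2.2) ≤ n * (L₁ + η / 8) := by
    have : 1 / (n : ℝ) * mutualInfo (c.law Q) (fun ω => ω.1.2.1) (fun ω => ω.2.2.2) ≤ _ := hl₁
    rwa [one_div, inv_mul_le_iff₀ hnr] at this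
  have hl₂' : mutualInfo (c.law Q) (fun ω => ω.1.2.2) (fun ω => ω.2.2.1) ≤ n * (L₂ + η / 8) := by
    have : 1 / (n : ℝ) * mutualInfo (c.law Q) (fun ω => ω.1.2.2) (fun ω => ω.2.2.1) ≤ _ := hl₂
    rwa [one_div, inv_mul_le_iff₀ hnr] at this
  have hA := approxBounds_of_code hQ c p₀ p₁ p₂ (by positivity) he hl₁' hl₂'
  have hrate : ∀ {R : ℝ}, 0 ≤ R →
      R ≤ 1 / (n : ℝ) * (Real.log (Fintype.card (Msg n R)) / Real.log 2) + η / 24 := fun {R} hR => by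
    have h1 := mul_le_mul_of_nonneg_left (le_log_card_msg (n := n) hR) (one_div_pos.2 hnr).le
    have h2 : 1 / (n : ℝ) * (n * R - 1) = R - 1 / n := by field_simp
    linarith
  have hleak : ∀ L : ℝ, 1 / (n : ℝ) * (n * (L + η / 8)) ≤ L + η / 8 := fun L => by
    rw [← mul_assoc, one_div_mul_cancel hnr.ne', one_mul]
  have hslack : 3 * (η / 8) +
      1 / (n : ℝ) * (3 * (1 + η / (12 * (S + 1)) * (n * (R₀ + R₁ + R₂)))) ≤ η := by
    have h1 : 1 / (n : ℝ) * (3 * (1 + η / (12 * (S + 1)) * (n * (R₀ + R₁ + R₂)))) =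
        3 * (1 / n) + η / 4 * (S / (S + 1)) := by
      rw [← hS]
      field_simp
      ring
    have h2 : S / (S + 1) ≤ 1 := (div_le_one (by positivity)).2 (by linarith)
    have h3 := mul_le_mul_of_nonneg_left h2 (by positivity : 0 ≤ η / 4)
    linarith
  have hB := hA.rescale (one_div_pos.2 hnr).le (by positivity) ((hrate p₀).trans (by linarith))
    ((hrate p₁).trans (by linarith)) ((hrate p₂).trans (by linarith)) (hleak L₁) (hleak L₂) hslack
  refine mem_outerSet_of_approxBounds hQ (exists_hasProfile_of_code hQ c hn0 p₀ p₁ p₂) hη.le hL₁ hL₂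
    hB ?_ ?_ h₀ h₁ h₂
  · rw [← mul_sub]
    exact mul_le_mul_of_nonneg_left (min_le_left _ _) (one_div_pos.2 hnr).le
  · rw [← mul_sub]
    exact mul_le_mul_of_nonneg_left (min_le_right _ _) (one_div_pos.2 hnr).le

/-- Lowering a positive rate by `η`, and keeping a vanishing one. -/
theorem exists_lowered_rate {R η : ℝ} (hη : 0 < η) (hR : R = 0 ∨ η ≤ R) :
    ∃ R', ((R = 0 ∧ R' = 0) ∨ (R' = R - η ∧ 0 ≤ R')) ∧ |R - R'| ≤ η := by
  rcases hR with rfl | hR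
  · exact ⟨0, Or.inl ⟨rfl, rfl⟩, by simpa using hη.le⟩
  · exact ⟨R - η, Or.inr ⟨rfl, by linarith⟩, by simp [abs_of_pos hη]⟩

theorem capacityRegion_subset_outerRegion (hQ : ∀ x, Q x ∈ stdSimplex ℝ (Y₁ × Y₂)) (hL₁ : 0 ≤ L₁)
    (hL₂ : 0 ≤ L₂) : capacityRegion Q L₁ L₂ ⊆ outerRegion Q L₁ L₂ := by
  refine closure_minimal ?_ isClosed_closure
  rintro ⟨R₀, R₁, R₂⟩ h
  refine Metric.mem_closure_iff.2 fun ε hε => ?_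
  -- Membership in the closure allows η to be taken below ε and below every positive rate, so that
  -- the lowered rates stay nonnegative.
  have small : ∀ R : ℝ, 0 ≤ R → ∀ᶠ η in nhdsWithin (0 : ℝ) (Set.Ioi 0), R = 0 ∨ η ≤ R :=
    fun R hR => by
      rcases hR.eq_or_lt with h0 | h0
      · exact Filter.Eventually.of_forall fun _ => Or.inl h0.symm
      · exact (Filter.Eventually.filter_mono nhdsWithin_le_nhds (eventually_le_nhds h0)).mono
          fun _ => Or.inr
  obtain ⟨η, ⟨⟨⟨⟨s₀, s₁⟩, s₂⟩, hηε⟩, hη⟩⟩ := ((((small R₀ h.1).and (small R₁ h.2.1)).and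
    (small R₂ h.2.2.1)).and (Filter.Eventually.filter_mono nhdsWithin_le_nhds
      (eventually_lt_nhds hε)) |>.and self_mem_nhdsWithin).exists
  obtain ⟨R₀', h₀, d₀⟩ := exists_lowered_rate hη s₀
  obtain ⟨R₁', h₁, d₁⟩ := exists_lowered_rate hη s₁
  obtain ⟨R₂', h₂, d₂⟩ := exists_lowered_rate hη s₂
  refine ⟨(R₀', R₁', R₂'), exists_mem_outerSet_of_achievable hQ hL₁ hL₂ h hη h₀ h₁ h₂, ?_⟩
  refine lt_of_le_of_lt ?_ hηε
  simp only [Prod.dist_eq, Real.dist_eq]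
  exact max_le d₀ (max_le d₁ d₂)

end Main

end LeakageBC

theorem theorem2 {X Y₁ Y₂ : Type*} [Fintype X] [Fintype Y₁] [Fintype Y₂]
    (Q : X → Y₁ × Y₂ → ℝ) (hQ : ∀ x, Q x ∈ stdSimplex ℝ (Y₁ × Y₂)) :
    (∀ L₁ L₂ : ℝ, 0 ≤ L₁ → 0 ≤ L₂ →
      LeakageBC.capacityRegion Q L₁ L₂ ⊆ LeakageBC.outerRegion Q L₁ L₂ ∧
      Convex ℝ (LeakageBC.outerRegion Q L₁ L₂)) ∧
    LeakageBC.outerRegionInactive Q = LeakageBC.uvwRegion Q ∧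
    (∃ Λ : ℝ, 0 ≤ Λ ∧ ∀ L₁ L₂ : ℝ, Λ ≤ L₁ → Λ ≤ L₂ →
      LeakageBC.outerRegion Q L₁ L₂ = LeakageBC.uvwRegion Q) := by
  refine ⟨fun L₁ L₂ hL₁ hL₂ => ⟨LeakageBC.capacityRegion_subset_outerRegion hQ hL₁ hL₂,
    (LeakageBC.convex_outerSet hQ L₁ L₂).closure⟩, LeakageBC.outerRegionInactive_eq_uvwRegion hQ,
    2 * (Real.log (Fintype.card Y₁) / Real.log 2) + 2 * (Real.log (Fintype.card Y₂) / Real.log 2),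
    ?_, fun L₁ L₂ hL₁ hL₂ => (LeakageBC.outerRegion_eq_outerRegionInactive hQ hL₁ hL₂).trans
      (LeakageBC.outerRegionInactive_eq_uvwRegion hQ)⟩
  have h₁ : 0 ≤ Real.log (Fintype.card Y₁) / Real.log 2 :=
    div_nonneg (Real.log_natCast_nonneg _) LeakageBC.log_two_pos.le
  have h₂ : 0 ≤ Real.log (Fintype.card Y₂) / Real.log 2 :=
    div_nonneg (Real.log_natCast_nonneg _) LeakageBC.log_two_pos.le
  positivity
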